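/- **Setting.** Let $\pi_{\mathrm b}\colon\mathbb R\to\mathbb R$ be measurable and of at most polynomial decay: there is a polynomial $p_{\mathrm b}\colon\mathbb R\to(0,\infty)$ with $1\le p_{\mathrm b}(z)\pi_{\mathrm b}(z)$ for all $z\in\mathbb R$. Let $\nu>1$, $C>\frac{1}{2^{3/2}\pi}$, $M>0$, and let $d,N,n\ge 1$ be integers. All random variables live on a probability space $(\Omega,\mathcal F,\mathbb P)$; $\|\cdot\|$ is the Euclidean norm. * *Hidden weights.* $A=(A_1,\dots,A_N)$ are i.i.d. $\mathbb R^d$-valued with the multivariate $t$-distribution $t_\nu(0,\mathbb 1_d)$, i.e. with density $x\mapsto\frac{\Gamma((\nu+d)/2)}{\Gamma(\nu/2)\nu^{d/2}\pi^{d/2}}(1+\nu^{-1}\|x\|^2)^{-(\nu+d)/2}$; $B=(B_1,\dots,B_N)$ are i.i.d. real with Lebesgue density $\pi_{\mathrm b}$; $A$ and $B$ are independent. For $W\in\mathbb R^N$ put $H^{A,B}_W(x)=\sum_{i=1}^N W_i\max(A_i\cdot x+B_i,0)$. * *Data.* $D_n=((X_1,Y_1),\dots,(X_n,Y_n))$ are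 i.i.d. $\mathbb R^d\times\mathbb R$-valued, independent of $(A,B)$, with $Y_1$ integrable and $\|X_1\|_\infty\le M$ a.s. The test point $\bar X$ has the law of $X_1$ and is independent of $(A,B,D_n)$. * *Target.* $H\colon\mathbb R^d\to\mathbb R$ is of the form $H(x)=\mathbb E[\Phi(x+V)]$ for all $x\in\mathbb R^d$, with $\Phi\in L^1(\mathbb R^d)$ and an $\mathbb R^d$-valued random vector $V$ satisfying $|\mathbb E[e^{i\xi\cdot V}]|\le e^{-C\|\xi\|^2}$ for all $\xi\in\mathbb R^d$. It is the regression function: $H(X_1)=\mathbb E[Y_1\mid X_1]$ a.s. Moreover $|H(x)|\le L$ for all $x$, where $L>0$, and the conditional noise variance is bounded: $\mathbb E[(Y_1-H(X_1))^2]<\infty$ and $\mathbb E[(Y_1-H(X_1))^2\mid X_1]\le\sigma^2$ a.s., where $\sigma\ge 0$ (for instance $\sigma^2=\sup_{x}\mathbb E[(Y_1-H(X_1))^2\mid X_1=x]$). * *Estimator.* $\widehat W$ is any $\sigma(A,B,D_n)$-measurable $\mathbb R^N$-valued random vector that minimizes the empirical risk $\frac1n\sum_{i=1}^n(H^{A,B}_W(X_i)-Y_i)^2$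 almost surely among all $\sigma(A,B,D_n)$-measurable $\mathbb R^N$-valued random vectors $W$. Let $T_L(u)=\max(\min(u,L),-L)$. **Theorem.** There exist $k\in\mathbb N$, depending only on $\pi_{\mathrm b}$, and $\widetilde C_{\mathrm{app}}>0$, depending only on $\nu,\pi_{\mathrm b},C,M$ (in particular not on $d$, $n$, $N$, $H$, $\sigma$, $L$ or the law of the data), such that in this setting $$\mathbb E\big[|H(\bar X)-T_L(H^{A,B}_{\widehat W}(\bar X))|^2\big]^{1/2}\le \widetilde C_{\mathrm{app}}\max(\sigma,L)\frac{(\log(n)+1)^{1/2}\sqrt N}{\sqrt n}+\frac{\widetilde C_{\mathrm{app}}\|\Phi\|_{L^1(\mathbb R^d)}(\nu+d)^{k+3}}{\sqrt N}.$$ -/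

import Mathlib

open MeasureTheory ProbabilityTheory

namespace RandomFeature

/-- Density of the multivariate `t`-distribution `t_ν(0, 1_d)` on `ℝ^d` (with the Euclidean norm). -/
noncomputable def studentTDensity (d : ℕ) (ν : ℝ) (x : EuclideanSpace ℝ (Fin d)) : ℝ :=
  Real.Gamma ((ν + d) / 2) /
      (Real.Gamma (ν / 2) * ν ^ ((d : ℝ) / 2) * Real.pi ^ ((d : ℝ) / 2)) *
    (1 + ν⁻¹ * ‖x‖ ^ 2) ^ (-(ν + d) / 2)

/-- The multivariate `t`-distribution `t_ν(0, 1_d)`. -/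
noncomputable def studentT (d : ℕ) (ν : ℝ) : Measure (EuclideanSpace ℝ (Fin d)) :=
  volume.withDensity (fun x => ENNReal.ofReal (studentTDensity d ν x))

/-- `π_b` has at most polynomial decay: there is a polynomial `p_b : ℝ → (0,∞)` with
`1 ≤ p_b(z) π_b(z)` for all `z`. -/
def AtMostPolynomialDecay (πb : ℝ → ℝ) : Prop :=
  ∃ p : Polynomial ℝ, (∀ z, 0 < p.eval z) ∧ ∀ z, 1 ≤ p.eval z * πb z

/-- `Z_i`, `i ∈ ι`, are i.i.d. random variables. -/
structure IsIID {Ω ι E : Type*} [MeasurableSpace Ω] [MeasurableSpace E] (P : Measure Ω)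
    (Z : ι → Ω → E) : Prop where
  measurable : ∀ i, Measurable (Z i)
  indep : iIndepFun Z P
  identDistrib : ∀ i j, IdentDistrib (Z i) (Z j) P P

/-- The ReLU activation function. -/
def relu (z : ℝ) : ℝ := max z 0

/-- The network `H_w^{a,b}(x) = ∑ i, w_i ϱ(a_i · x + b_i)`. -/
noncomputable def network {d N : ℕ} (a : Fin N → EuclideanSpace ℝ (Fin d)) (b w : Fin N → ℝ)
    (x : EuclideanSpace ℝ (Fin d)) : ℝ :=
  ∑ i, w i * relu (inner ℝ (a i) x + b i)

/-- The empirical risk `(1/n) ∑ i, (f(x_i) - y_i)^2` of `f` on the sample `(x_i, y_i)`. -/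
noncomputable def empiricalRisk {d n : ℕ} (f : EuclideanSpace ℝ (Fin d) → ℝ)
    (x : Fin n → EuclideanSpace ℝ (Fin d)) (y : Fin n → ℝ) : ℝ :=
  (1 / (n : ℝ)) * ∑ i, (f (x i) - y i) ^ 2

/-- The truncation `T_L(u) = max(min(u, L), -L)`. -/
def truncate (L u : ℝ) : ℝ := max (min u L) (-L)

section Estimator

variable {Ω : Type*} [MeasurableSpace Ω] {d N n : ℕ}

/-- The random element `(A, B)`, the hidden weights. -/
def hidden (A : Fin N → Ω → EuclideanSpace ℝ (Fin d)) (B : Fin N → Ω → ℝ) (ω : Ω) :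
    (Fin N → EuclideanSpace ℝ (Fin d)) × (Fin N → ℝ) :=
  (fun i => A i ω, fun i => B i ω)

/-- The random element `D_n = ((X_1, Y_1), …, (X_n, Y_n))`, the data. -/
def data (X : Fin n → Ω → EuclideanSpace ℝ (Fin d)) (Y : Fin n → Ω → ℝ) (ω : Ω) :
    Fin n → EuclideanSpace ℝ (Fin d) × ℝ :=
  fun i => (X i ω, Y i ω)

/-- The random element `(A, B, D_n)`. -/
def observed (A : Fin N → Ω → EuclideanSpace ℝ (Fin d)) (B : Fin N → Ω → ℝ)
    (X : Fin n → Ω → EuclideanSpace ℝ (Fin d)) (Y : Fin n → Ω → ℝ) (ω : Ω) :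
    ((Fin N → EuclideanSpace ℝ (Fin d)) × (Fin N → ℝ)) ×
      (Fin n → EuclideanSpace ℝ (Fin d) × ℝ) :=
  (hidden A B ω, data X Y ω)

/-- `W` is `σ(A, B, D_n)`-measurable. -/
def IsAdmissible (A : Fin N → Ω → EuclideanSpace ℝ (Fin d)) (B : Fin N → Ω → ℝ)
    (X : Fin n → Ω → EuclideanSpace ℝ (Fin d)) (Y : Fin n → Ω → ℝ)
    (W : Ω → Fin N → ℝ) : Prop :=
  Measurable[MeasurableSpace.comap (observed A B X Y) inferInstance] W

/-- `What` minimizes the empirical risk of `H_W^{A,B}` among all `σ(A, B, D_n)`-measurable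
`ℝ^N`-valued random vectors `W`. -/
def IsLeastSquaresWeight (P : Measure Ω)
    (A : Fin N → Ω → EuclideanSpace ℝ (Fin d)) (B : Fin N → Ω → ℝ)
    (X : Fin n → Ω → EuclideanSpace ℝ (Fin d)) (Y : Fin n → Ω → ℝ)
    (What : Ω → Fin N → ℝ) : Prop :=
  IsAdmissible A B X Y What ∧
    ∀ W : Ω → Fin N → ℝ, IsAdmissible A B X Y W → ∀ᵐ ω ∂P,
      empiricalRisk (network (fun i => A i ω) (fun i => B i ω) (What ω))
          (fun i => X i ω) (fun i => Y i ω) ≤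
        empiricalRisk (network (fun i => A i ω) (fun i => B i ω) (W ω))
          (fun i => X i ω) (fun i => Y i ω)

end Estimator

end RandomFeature

/-! ### Shatter counts for truncated linear classes -/

namespace RandomFeature


/-! Once the hidden weights are frozen, the networks form a linear space of functions of dimension
at most `N`. The risk therefore splits into an oracle inequality for truncated linear least squares
and an approximation bound for one explicit vector of outer weights, which depends on the hidden
weights but not on the data.

Estimation. The least-squares fit is the orthogonal projection of the responses onto the column
space of the design. Its empirical distance to `H` is at most that of any competitor plus the
projected noise, whose expected squared norm is at most `σ²` times the rank, hence at most `σ² N`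
(`IsRegressionLaw.lintegral_norm_sq_hatMap_le`). To pass from the empirical to the true error, the
level sets `{(H - T_L f)² > t}` are used: by Sauer–Shelah they have at most `(2n+1)^(2N)` traces on
`2n` points, and a symmetrized exponential moment with Jensen bounds the mass of a data-dependent
level set by twice its empirical mass plus a term of order `N log n / n`
(`measure_le_two_mul_empirical_add`). Allowing the factor 2 is what gives `1/n` in place of `1/√n`
for the squared error. Integration over `0 < t < 4L²` yields the oracle inequality.

Approximation. By Fourier inversion `H` is a superposition of plane waves with amplitude at most
`(2π)^(-d) ‖Φ‖₁ exp(-C‖ξ‖²)` (`exists_planeWave_representation`). On a bounded interval a wave is an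
integral of functions `u ↦ relu (u + b)` with a bounded, compactly supported coefficient
(`integral_waveCoeff_mul_relu`). Dividing by the sampling densities turns `H(x)` into the mean of a
weighted random feature, so averaging `N` copies gives squared error at most the second moment over
`N`.

The crux is the dimension dependence of this second moment
(`exists_lintegral_sq_importanceWeight_le`). The inverse `t`-density costs a Gaussian `exp(C‖ξ‖²)`
and a factor linear in `ν + d`; the inverse of `π_b` costs an exponential of arbitrarily small rate.
The remaining factor is at most `(8π²C²)^(-d/2)`, and `8π²C² > 1` is exactly the assumption on `C`.
Only a factor `ν + d` survives in the second moment, so `k = 0` suffices. -/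

theorem sum_choose_le_pow (m N : ℕ) : ∑ k ∈ Finset.Iic N, m.choose k ≤ (m + 1) ^ N := by
  rw [← Nat.range_succ_eq_Iic]
  induction N with
  | zero => simp
  | succ N ih =>
    rw [Finset.sum_range_succ]
    have h1 : m.choose (N + 1) ≤ m * (m + 1) ^ N := by
      refine (Nat.choose_le_pow m (N + 1)).trans ?_
      rw [pow_succ']
      gcongr
      omega
    calc _ ≤ (m + 1) ^ N + m * (m + 1) ^ N := add_le_add ih h1
      _ = _ := by ring

/-- A finset shattered by the superlevel sets of an affine family indexed by `ℝ^N` has at most `N`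
elements. -/
theorem card_le_of_shatters_halfspaces {ι : Type*} [DecidableEq ι] {N : ℕ}
    (φ : ι → Fin N → ℝ) (c : ι → ℝ) (s : Finset ι)
    (hs : ∀ t ⊆ s, ∃ q : Fin N → ℝ, ∀ i ∈ s, i ∈ t ↔ c i < ∑ j, q j * φ i j) : s.card ≤ N := by
  by_contra! hcard
  have hdep : ¬ LinearIndependent ℝ (fun i : s => φ i) := fun hli => by
    have := hli.fintype_card_le_finrank
    simp at this
    omega
  obtain ⟨g, hg, i₀, hi₀⟩ := Fintype.not_linearIndependent_iff.1 hdep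
  -- A dependence `g` makes `∑ g i * (⟨q, φ i⟩ - c i)` independent of `q`. Picking out `{g > 0}`
  -- makes this constant positive, while picking out `{g < 0}` makes it nonpositive. The strict sign
  -- needs some `g i > 0`, arranged below by replacing `g` with `-g` if necessary.
  have key : ∀ g : s → ℝ, ∑ i, g i • φ i = 0 → (∃ i, 0 < g i) → False := by
    rintro g hg ⟨i₀, hi₀⟩
    have hlin : ∀ q : Fin N → ℝ, ∑ i, g i * ∑ j, q j * φ i j = 0 := fun q => by
      have : ∀ j, ∑ i, g i * φ i j = 0 := fun j => by simpa using congrFun hg j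
      simp_rw [Finset.mul_sum]
      rw [Finset.sum_comm]
      refine Finset.sum_eq_zero fun j _ => ?_
      calc _ = q j * ∑ i, g i * φ i j := by
            rw [Finset.mul_sum]; exact Finset.sum_congr rfl fun _ _ => by ring
        _ = 0 := by rw [this, mul_zero]
    have hsum : ∀ q : Fin N → ℝ,
        ∑ i : s, g i * (∑ j, q j * φ i j - c i) = - ∑ i : s, g i * c i := fun q => by
      simp_rw [mul_sub]
      rw [Finset.sum_sub_distrib, hlin, zero_sub]
    classical
    obtain ⟨q, hq⟩ := hs ((Finset.univ.filter fun i : s => 0 < g i).image Subtype.val)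
      (fun x hx => by
        obtain ⟨y, -, rfl⟩ := Finset.mem_image.1 hx
        exact y.2)
    obtain ⟨q', hq'⟩ := hs ((Finset.univ.filter fun i : s => g i < 0).image Subtype.val)
      (fun x hx => by
        obtain ⟨y, -, rfl⟩ := Finset.mem_image.1 hx
        exact y.2)
    have hq2 : ∀ i : s, 0 < g i ↔ c i < ∑ j, q j * φ i j := fun i => by
      rw [← hq i i.2]; simp
    have hq2' : ∀ i : s, g i < 0 ↔ c i < ∑ j, q' j * φ i j := fun i => by
      rw [← hq' i i.2]; simp
    have h1 : 0 < - ∑ i : s, g i * c i := by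
      rw [← hsum q]
      refine Finset.sum_pos' (fun i _ => ?_) ⟨i₀, Finset.mem_univ _, ?_⟩
      · by_cases h : 0 < g i
        · exact mul_nonneg h.le (sub_nonneg.2 ((hq2 i).1 h).le)
        · exact mul_nonneg_of_nonpos_of_nonpos (not_lt.1 h)
            (sub_nonpos.2 (not_lt.1 fun h' => h ((hq2 i).2 h')))
      · exact mul_pos hi₀ (sub_pos.2 ((hq2 i₀).1 hi₀))
    have h2 : - ∑ i : s, g i * c i ≤ 0 := by
      rw [← hsum q']
      refine Finset.sum_nonpos fun i _ => ?_
      by_cases h : g i < 0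
      · exact mul_nonpos_of_nonpos_of_nonneg h.le (sub_nonneg.2 ((hq2' i).1 h).le)
      · exact mul_nonpos_of_nonneg_of_nonpos (not_lt.1 h)
          (sub_nonpos.2 (not_lt.1 fun h' => h ((hq2' i).2 h')))
    linarith
  rcases lt_or_gt_of_ne hi₀ with h | h
  · exact key (fun i => - g i) (by simpa [Finset.sum_neg_distrib] using hg) ⟨i₀, by simpa using h⟩
  · exact key g hg ⟨i₀, h⟩

open Classical in
/-- Superlevel sets of an affine family indexed by `ℝ^N` cut out polynomially many subsets of a
finite set. -/
theorem card_halfspace_traces_le {ι : Type*} [Fintype ι] {N : ℕ}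
    (φ : ι → Fin N → ℝ) (c : ι → ℝ) :
    (Set.range fun q : Fin N → ℝ => Finset.univ.filter fun i => c i < ∑ j, q j * φ i j).ncard ≤
      (Fintype.card ι + 1) ^ N := by
  set R := Set.range fun q : Fin N → ℝ => Finset.univ.filter fun i => c i < ∑ j, q j * φ i j
  have hfin : R.Finite := Set.toFinite _
  rw [Set.ncard_eq_toFinset_card _ hfin]
  set 𝒜 := hfin.toFinset
  -- The Vapnik–Chervonenkis dimension is at most `N`; Sauer–Shelah then bounds the number of
  -- traces.
  have hvc : 𝒜.vcDim ≤ N := by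
    refine Finset.sup_le fun s hs => card_le_of_shatters_halfspaces φ c s fun t ht => ?_
    obtain ⟨u, hu, hut⟩ := Finset.mem_shatterer.1 hs ht
    obtain ⟨q, rfl⟩ := hfin.mem_toFinset.1 hu
    refine ⟨q, fun i hi => ?_⟩
    rw [← hut]
    simp [hi]
  refine (Finset.card_le_card_shatterer 𝒜).trans (Finset.card_shatterer_le_sum_vcDim.trans ?_)
  refine le_trans ?_ (sum_choose_le_pow _ N)
  exact Finset.sum_le_sum_of_subset (Finset.Iic_subset_Iic.2 hvc)

theorem lt_truncate_iff (L u c : ℝ) : c < truncate L u ↔ (c < u ∧ c < L) ∨ c < -L := by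
  simp [truncate]

theorem truncate_lt_iff (L u c : ℝ) : truncate L u < c ↔ (u < c ∨ L < c) ∧ -L < c := by
  simp [truncate]

open Classical in
/-- The sets `{(m - T_L ⟨q, φ⟩)² > t}`, `q ∈ ℝ^N`, cut out polynomially many subsets of a finite
set. -/
theorem card_truncated_traces_le {ι : Type*} [Fintype ι] {N : ℕ}
    (φ : ι → Fin N → ℝ) (m : ι → ℝ) (L t : ℝ) (ht : 0 ≤ t) :
    (Set.range fun (q : Fin N → ℝ) (i : ι) =>
      decide (t < (m i - truncate L (∑ j, q j * φ i j)) ^ 2)).ncard ≤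
      (Fintype.card ι + 1) ^ (2 * N) := by
  set R₁ := Set.range fun q : Fin N → ℝ =>
    Finset.univ.filter fun i => m i + √t < ∑ j, q j * φ i j
  set R₂ := Set.range fun q : Fin N → ℝ =>
    Finset.univ.filter fun i => - (m i - √t) < ∑ j, q j * φ i j
  have h₁ : R₁.ncard ≤ _ := card_halfspace_traces_le φ _
  have h₂ : R₂.ncard ≤ _ := card_halfspace_traces_le φ _
  -- `(m - T)² > t` means `T > m + √t` or `T < m - √t`. Truncation only adds conditions free of `q`,
  -- so the trace is a function of one upper and one lower half-space trace; this doubles the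
  -- exponent.
  let f : Finset ι × Finset ι → ι → Bool := fun S i =>
    decide (((i ∈ S.1 ∧ m i + √t < L) ∨ m i + √t < -L) ∨
      ((i ∈ S.2 ∨ L < m i - √t) ∧ -L < m i - √t))
  have hsub : (Set.range fun (q : Fin N → ℝ) (i : ι) =>
      decide (t < (m i - truncate L (∑ j, q j * φ i j)) ^ 2)) ⊆ f '' (R₁ ×ˢ R₂) := by
    rintro _ ⟨q, rfl⟩
    -- A lower half-space of `q` is an upper half-space of `-q`.
    refine ⟨(_, _), ⟨⟨q, rfl⟩, ⟨-q, rfl⟩⟩, ?_⟩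
    funext i
    simp only [f, decide_eq_decide]
    have hsq : t < (m i - truncate L (∑ j, q j * φ i j)) ^ 2 ↔
        m i + √t < truncate L (∑ j, q j * φ i j) ∨ truncate L (∑ j, q j * φ i j) < m i - √t := by
      rw [← Real.sqrt_lt_sqrt_iff ht, Real.sqrt_sq_eq_abs, lt_abs]
      constructor
      · rintro (h | h)
        · right; linarith
        · left; linarith
      · rintro (h | h)
        · right; linarith
        · left; linarith
    have hneg : - (m i - √t) < ∑ j, (-q) j * φ i j ↔ ∑ j, q j * φ i j < m i - √t := by
      simp only [Pi.neg_apply, neg_mul, Finset.sum_neg_distrib, neg_lt_neg_iff]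
    rw [hsq, lt_truncate_iff, truncate_lt_iff]
    have mem_iff : ∀ p : ι → Prop, i ∈ Finset.univ.filter p ↔ p i := fun p => by simp
    exact or_congr (or_congr (and_congr_left' (mem_iff _)) Iff.rfl)
      (and_congr_left' (or_congr ((mem_iff _).trans hneg) Iff.rfl))
  calc _ ≤ (f '' (R₁ ×ˢ R₂)).ncard := Set.ncard_le_ncard hsub (Set.toFinite _)
    _ ≤ (R₁ ×ˢ R₂).ncard := Set.ncard_image_le (Set.toFinite _)
    _ = R₁.ncard * R₂.ncard := Set.ncard_prod
    _ ≤ (Fintype.card ι + 1) ^ N * (Fintype.card ι + 1) ^ N := Nat.mul_le_mul h₁ h₂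
    _ = _ := by rw [two_mul, pow_add]

end RandomFeature

/-! ### Symmetrization and a relative deviation inequality -/

namespace RandomFeature

open scoped ENNReal

/-- Superadditivity of the lower integral requires no measurability; it is applied to sums over
traces, whose measurability in the sample is not established. -/
theorem le_lintegral_finset_sum {α ι : Type*} [MeasurableSpace α] (μ : Measure α) (s : Finset ι)
    (f : ι → α → ℝ≥0∞) : ∑ i ∈ s, ∫⁻ a, f i a ∂μ ≤ ∫⁻ a, ∑ i ∈ s, f i a ∂μ := by
  classical
  induction s using Finset.induction_on with
  | empty => simp
  | insert i s hi ih =>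
    simp_rw [Finset.sum_insert hi]
    exact (add_le_add le_rfl ih).trans (le_lintegral_add _ _)

section Swap

variable {𝒵 : Type*} {n : ℕ}

/-- Swap the two entries of the `i`-th pair whenever `ε i` is true. -/
def swapPairs (ε : Fin n → Bool) (u : Fin n → 𝒵 × 𝒵) : Fin n → 𝒵 × 𝒵 :=
  fun i => if ε i then (u i).swap else u i

theorem swapPairs_injective (ε : Fin n → Bool) :
    Function.Injective (swapPairs (𝒵 := 𝒵) ε) := by
  intro u v huv
  funext i
  have h := congrFun huv i
  unfold swapPairs at h
  split_ifs at h
  · exact Prod.swap_injective h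
  · exact h

theorem swapPairs_swapPairs (ε : Fin n → Bool) (u : Fin n → 𝒵 × 𝒵) :
    swapPairs ε (swapPairs ε u) = u := by
  funext i
  unfold swapPairs
  split_ifs <;> simp

theorem measurePreserving_swapPairs [MeasurableSpace 𝒵] (ρ : Measure 𝒵) [SigmaFinite ρ]
    (ε : Fin n → Bool) :
    MeasurePreserving (swapPairs (𝒵 := 𝒵) ε) (Measure.pi fun _ => ρ.prod ρ)
      (Measure.pi fun _ => ρ.prod ρ) := by
  refine measurePreserving_pi (fun _ => ρ.prod ρ) (fun _ => ρ.prod ρ)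
    (f := fun i p => if ε i then p.swap else p) fun i => ?_
  by_cases h : ε i
  · simpa [h] using (Measure.measurePreserving_swap (μ := ρ) (ν := ρ))
  · simp only [h]
    exact MeasurePreserving.id (ρ.prod ρ)

/-- Weight of a pair of indicators, equal to `exp (s (b - 2 a))` with `exp s = 3/2`. -/
noncomputable def pairWeight (p : Bool × Bool) : ℝ≥0∞ :=
  ENNReal.ofReal ((if p.2 then 3 / 2 else 1) * (if p.1 then 4 / 9 else 1))

/-- With `x = exp s` the critical case is one indicator on and one off: `x + x⁻² ≤ 2`, that is `(x -
1)(x² - x - 1) ≤ 0`. It holds for `x` between 1 and the golden ratio; `3/2` is a convenient choice.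
-/
theorem pairWeight_add_swap_le (p : Bool × Bool) : pairWeight p + pairWeight p.swap ≤ 2 := by
  unfold pairWeight
  rw [← ENNReal.ofReal_add (by positivity) (by positivity),
    show (2 : ℝ≥0∞) = ENNReal.ofReal 2 by simp]
  refine ENNReal.ofReal_le_ofReal ?_
  rcases p with ⟨a, b⟩
  cases a <;> cases b <;> norm_num

theorem sum_prod_pairWeight_swapPairs_le (τ : Fin n → Bool × Bool) :
    ∑ ε : Fin n → Bool, ∏ i, pairWeight (swapPairs ε τ i) ≤ 2 ^ n := by
  have h : ∀ ε : Fin n → Bool, ∏ i, pairWeight (swapPairs ε τ i) =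
      ∏ i, (fun i b => pairWeight (if b then (τ i).swap else τ i)) i (ε i) := fun ε => rfl
  rw [Finset.sum_congr rfl fun ε _ => h ε,
    ← Fintype.prod_sum (fun i (b : Bool) => pairWeight (if b then (τ i).swap else τ i))]
  calc _ ≤ ∏ _i : Fin n, (2 : ℝ≥0∞) := by
        refine Finset.prod_le_prod' fun i _ => ?_
        simpa [add_comm] using pairWeight_add_swap_le (τ i)
    _ = 2 ^ n := by simp

variable {Q : Type*}

open Classical in
/-- The indicators of `S q` at a family of pairs of points. -/
noncomputable def pairTrace (S : Q → Set 𝒵) (u : Fin n → 𝒵 × 𝒵) (q : Q) : Fin n → Bool × Bool :=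
  fun i => (decide ((u i).1 ∈ S q), decide ((u i).2 ∈ S q))

theorem pairTrace_swapPairs (S : Q → Set 𝒵) (ε : Fin n → Bool) (u : Fin n → 𝒵 × 𝒵) (q : Q) :
    pairTrace S (swapPairs ε u) q = swapPairs ε (pairTrace S u q) := by
  funext i
  have aux : ∀ p : 𝒵 × 𝒵, u i = p → swapPairs ε u i = if ε i then p.swap else p := fun p hp => by
    rw [← hp]; rfl
  unfold pairTrace
  rw [aux _ rfl]
  by_cases h : ε i
  · rw [if_pos h, swapPairs, if_pos h]; rfl
  · rw [if_neg h, swapPairs, if_neg h]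

open Classical in
/-- All traces of the family `S` on a family of pairs of points. -/
noncomputable def pairTraces (S : Q → Set 𝒵) (u : Fin n → 𝒵 × 𝒵) : Finset (Fin n → Bool × Bool) :=
  (Set.toFinite (Set.range (pairTrace S u))).toFinset

theorem pairTraces_swapPairs (S : Q → Set 𝒵) (ε : Fin n → Bool) (u : Fin n → 𝒵 × 𝒵) :
    pairTraces S (swapPairs ε u) =
      (pairTraces S u).map ⟨swapPairs ε, swapPairs_injective ε⟩ := by
  ext τ
  simp [pairTraces, pairTrace_swapPairs]

/-- The pair law is invariant under each of the `2^n` swaps, and a swap permutes the traces along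
with the points. Averaging over all swaps factorizes over the pairs, so each trace contributes at
most 1. Summing over all traces replaces a supremum over the family, hence a data-dependent choice
is covered. -/
theorem lintegral_sum_pairTraces_le [MeasurableSpace 𝒵] (ρ : Measure 𝒵) [IsProbabilityMeasure ρ]
    (S : Q → Set 𝒵) (T : ℕ) (hT : ∀ u : Fin n → 𝒵 × 𝒵, (pairTraces S u).card ≤ T) :
    ∫⁻ u : Fin n → 𝒵 × 𝒵, ∑ τ ∈ pairTraces S u, ∏ i, pairWeight (τ i)
      ∂(Measure.pi fun _ => ρ.prod ρ) ≤ T := by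
  set μ : Measure (Fin n → 𝒵 × 𝒵) := Measure.pi fun _ => ρ.prod ρ
  set G : (Fin n → 𝒵 × 𝒵) → ℝ≥0∞ := fun u => ∑ τ ∈ pairTraces S u, ∏ i, pairWeight (τ i)
  have hswap : ∀ ε : Fin n → Bool, ∫⁻ u, G (swapPairs ε u) ∂μ = ∫⁻ u, G u ∂μ := fun ε =>
    let e : (Fin n → 𝒵 × 𝒵) ≃ᵐ (Fin n → 𝒵 × 𝒵) :=
      { toFun := swapPairs ε
        invFun := swapPairs ε
        left_inv := swapPairs_swapPairs ε
        right_inv := swapPairs_swapPairs ε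
        measurable_toFun := (measurePreserving_swapPairs ρ ε).measurable
        measurable_invFun := (measurePreserving_swapPairs ρ ε).measurable }
    (MeasurePreserving.lintegral_map_equiv G e (measurePreserving_swapPairs ρ ε)).symm
  have havg : ∀ u, ∑ ε : Fin n → Bool, G (swapPairs ε u) ≤ 2 ^ n * T := fun u => by
    simp_rw [G, pairTraces_swapPairs, Finset.sum_map]
    rw [Finset.sum_comm]
    calc _ ≤ ∑ _τ ∈ pairTraces S u, (2 : ℝ≥0∞) ^ n :=
          Finset.sum_le_sum fun τ _ => sum_prod_pairWeight_swapPairs_le τ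
      _ = (pairTraces S u).card * 2 ^ n := by simp
      _ ≤ T * 2 ^ n := by gcongr; exact_mod_cast hT u
      _ = _ := mul_comm _ _
  have h2 : (2 : ℝ≥0∞) ^ n * ∫⁻ u, G u ∂μ ≤ 2 ^ n * T := by
    calc (2 : ℝ≥0∞) ^ n * ∫⁻ u, G u ∂μ = ∑ ε : Fin n → Bool, ∫⁻ u, G (swapPairs ε u) ∂μ := by
          simp_rw [hswap]; simp
      _ ≤ ∫⁻ u, ∑ ε : Fin n → Bool, G (swapPairs ε u) ∂μ := le_lintegral_finset_sum _ _ _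
      _ ≤ ∫⁻ _u, 2 ^ n * T ∂μ := lintegral_mono havg
      _ = 2 ^ n * T := by simp
  exact (ENNReal.mul_le_mul_iff_right (by simp) (by simp)).1 h2

end Swap

open Classical in
/-- Relative deviation inequality in expectation: the mass of a data-dependent set drawn from a
family with at most `T` traces on `2n` points is at most twice its empirical mass plus
`log T / (n log (3/2))`. -/
theorem measure_le_two_mul_empirical_add {𝒵 Q : Type*} [MeasurableSpace 𝒵] {n : ℕ} (hn : n ≠ 0)
    (ρ : Measure 𝒵) [IsProbabilityMeasure ρ] (S : Q → Set 𝒵) (a : (Fin n → 𝒵) → Q)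
    (hmeas : MeasurableSet {p : (Fin n → 𝒵) × 𝒵 | p.2 ∈ S (a p.1)})
    (T : ℕ) (hT : ∀ u : Fin n → 𝒵 × 𝒵, (pairTraces S u).card ≤ T) :
    ((Measure.pi fun _ => ρ).prod ρ) {p : (Fin n → 𝒵) × 𝒵 | p.2 ∈ S (a p.1)} ≤
      ENNReal.ofReal (2 / n) * ∑ i, (Measure.pi fun _ => ρ) {z : Fin n → 𝒵 | z i ∈ S (a z)} +
      ENNReal.ofReal (Real.log T / (n * Real.log (3 / 2))) := by
  set μ : Measure (Fin n → 𝒵) := Measure.pi fun _ => ρ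
  set A := {p : (Fin n → 𝒵) × 𝒵 | p.2 ∈ S (a p.1)}
  have hs : 0 < Real.log (3 / 2) := Real.log_pos (by norm_num)
  set s := Real.log (3 / 2)
  have hexp : Real.exp s = 3 / 2 := Real.exp_log (by norm_num)
  -- indicators at the ghost sample and at the sample
  let f : Fin n → (Fin n → 𝒵) × (Fin n → 𝒵) → ℝ := fun i p => A.indicator 1 (p.1, p.2 i)
  let g : Fin n → (Fin n → 𝒵) × (Fin n → 𝒵) → ℝ := fun i p => A.indicator 1 (p.1, p.1 i)
  have hfm : ∀ i, Measurable (f i) := fun i =>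
    (measurable_one.indicator hmeas).comp (by fun_prop)
  have hgm : ∀ i, Measurable (g i) := fun i =>
    (measurable_one.indicator hmeas).comp (by fun_prop)
  have hind : ∀ x, |A.indicator (1 : (Fin n → 𝒵) × 𝒵 → ℝ) x| ≤ 1 := fun x => by
    by_cases h : x ∈ A <;> simp [h]
  have hfi : ∀ i, Integrable (f i) (μ.prod μ) := fun i =>
    Integrable.of_bound (hfm i).aestronglyMeasurable 1 (ae_of_all _ fun x => hind _)
  have hgi : ∀ i, Integrable (g i) (μ.prod μ) := fun i =>
    Integrable.of_bound (hgm i).aestronglyMeasurable 1 (ae_of_all _ fun x => hind _)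
  have hfint : ∀ i, ∫ p, f i p ∂(μ.prod μ) = (μ.prod ρ).real A := fun i => by
    have hmp : MeasurePreserving (Prod.map id (fun z : Fin n → 𝒵 => z i)) (μ.prod μ) (μ.prod ρ) :=
      (MeasurePreserving.id μ).prod (measurePreserving_eval (fun _ : Fin n => ρ) i)
    rw [← integral_indicator_one hmeas, ← hmp.map_eq, integral_map hmp.measurable.aemeasurable
      (measurable_one.indicator hmeas).aestronglyMeasurable]
    rfl
  have hgint : ∀ i, ∫ p, g i p ∂(μ.prod μ) = μ.real {z | z i ∈ S (a z)} := fun i => by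
    have hm : MeasurableSet {z : Fin n → 𝒵 | z i ∈ S (a z)} :=
      hmeas.preimage (f := fun z : Fin n → 𝒵 => (z, z i)) (by fun_prop)
    have := integral_fun_fst (μ := μ) (ν := μ)
      (fun z => A.indicator (1 : (Fin n → 𝒵) × 𝒵 → ℝ) (z, z i))
    simp only [probReal_univ, one_smul] at this
    rw [← integral_indicator_one hm]
    exact this
  -- Weighting the empirical count by 2 gives the exponent a negative drift, so its exponential
  -- moment stays bounded by `T` with no variance term.
  let F : (Fin n → 𝒵) × (Fin n → 𝒵) → ℝ := fun p => s * ∑ i, (f i p - 2 * g i p)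
  have hFm : Measurable F := by fun_prop
  have hFi : Integrable F (μ.prod μ) :=
    (integrable_finsetSum _ fun i _ => (hfi i).sub ((hgi i).const_mul 2)).const_mul s
  have hFint : ∫ p, F p ∂(μ.prod μ) =
      s * (n * (μ.prod ρ).real A - 2 * ∑ i, μ.real {z | z i ∈ S (a z)}) := by
    simp only [F]
    rw [integral_const_mul, integral_finsetSum (f := fun i p => f i p - 2 * g i p) _
      fun i _ => (hfi i).sub ((hgi i).const_mul 2)]
    congr 1
    rw [Finset.mul_sum]
    calc _ = ∑ i, ((μ.prod ρ).real A - 2 * μ.real {z | z i ∈ S (a z)}) :=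
          Finset.sum_congr rfl fun i _ => by
            rw [integral_sub (hfi i) ((hgi i).const_mul 2), integral_const_mul, hfint, hgint]
      _ = _ := by simp [Finset.sum_sub_distrib]
  -- exponential moment
  let e := MeasurableEquiv.arrowProdEquivProdArrow 𝒵 𝒵 (Fin n)
  -- The selected set depends on the sample alone, but its trace on sample and ghost sample is one
  -- of the summands on the right.
  have hpt : ∀ u, ENNReal.ofReal (Real.exp (F (e u))) ≤
      ∑ τ ∈ pairTraces S u, ∏ i, pairWeight (τ i) := fun u => by
    have hmem : pairTrace S u (a (e u).1) ∈ pairTraces S u := by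
      simp [pairTraces]
    refine le_trans (le_of_eq ?_) (Finset.single_le_sum (fun _ _ => zero_le) hmem)
    simp only [F, Finset.mul_sum, Real.exp_sum]
    rw [ENNReal.ofReal_prod_of_nonneg fun i _ => (Real.exp_pos _).le]
    refine Finset.prod_congr rfl fun i _ => ?_
    unfold pairWeight pairTrace
    congr 1
    have e1 : (e u).1 i = (u i).1 := rfl
    have e2 : (e u).2 i = (u i).2 := rfl
    have h2 : Real.exp (-(s * 2)) = 4 / 9 := by
      rw [show -(s * 2) = -(s + s) by ring, Real.exp_neg, Real.exp_add, hexp]; norm_num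
    have h3 : Real.exp (s * (1 - 2)) = 3 / 2 * (4 / 9) := by
      rw [show s * (1 - 2) = -s by ring, Real.exp_neg, hexp]; norm_num
    by_cases ha : (u i).1 ∈ S (a (e u).1) <;> by_cases hb : (u i).2 ∈ S (a (e u).1) <;>
      simp [f, g, A, e1, e2, ha, hb, Set.indicator, hexp, h2, h3]
  have hlint : ∫⁻ p, ENNReal.ofReal (Real.exp (F p)) ∂(μ.prod μ) ≤ T := by
    have hmp : MeasurePreserving e (Measure.pi fun _ => ρ.prod ρ) (μ.prod μ) :=
      measurePreserving_arrowProdEquivProdArrow 𝒵 𝒵 (Fin n) (fun _ => ρ) (fun _ => ρ)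
    rw [MeasurePreserving.lintegral_map_equiv (fun p => ENNReal.ofReal (Real.exp (F p))) e hmp]
    exact (lintegral_mono hpt).trans (lintegral_sum_pairTraces_le ρ S T hT)
  have hexpi : Integrable (fun p => Real.exp (F p)) (μ.prod μ) := by
    refine ⟨(Real.measurable_exp.comp hFm).aestronglyMeasurable, ?_⟩
    rw [hasFiniteIntegral_iff_ofReal (ae_of_all _ fun p => (Real.exp_pos _).le)]
    exact hlint.trans_lt (by simp)
  -- Jensen turns the exponential moment into `E F ≤ log T`, which is the claim multiplied by `n *
  -- s`.
  have hjensen : Real.exp (∫ p, F p ∂(μ.prod μ)) ≤ T := by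
    calc _ ≤ ∫ p, Real.exp (F p) ∂(μ.prod μ) :=
          convexOn_exp.map_integral_le Real.continuous_exp.continuousOn isClosed_univ
            (by simp) hFi hexpi
      _ ≤ T := by
        rw [integral_eq_lintegral_of_nonneg_ae (ae_of_all _ fun p => (Real.exp_pos _).le)
          hexpi.1]
        exact ENNReal.toReal_le_of_le_ofReal (by positivity) (by simpa using hlint)
  have hTpos : (0 : ℝ) < T := (Real.exp_pos _).trans_le hjensen
  rw [← Real.le_log_iff_exp_le hTpos, hFint] at hjensen
  have hn' : (0 : ℝ) < n := by positivity
  have hreal : (μ.prod ρ).real A ≤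
      2 / n * ∑ i, μ.real {z | z i ∈ S (a z)} + Real.log T / (n * s) := by
    rw [← mul_le_mul_iff_right₀ (mul_pos hs hn')]
    calc _ = s * (n * (μ.prod ρ).real A - 2 * ∑ i, μ.real {z | z i ∈ S (a z)}) +
          s * (2 * ∑ i, μ.real {z | z i ∈ S (a z)}) := by ring
      _ ≤ Real.log T + s * (2 * ∑ i, μ.real {z | z i ∈ S (a z)}) := by gcongr
      _ = _ := by field_simp; ring
  have hT1 : 0 ≤ Real.log T := Real.log_natCast_nonneg T
  rw [← ENNReal.ofReal_toReal (measure_ne_top (μ.prod ρ) A)]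
  refine (ENNReal.ofReal_le_ofReal hreal).trans ?_
  rw [ENNReal.ofReal_add (by positivity) (by positivity), ENNReal.ofReal_mul (by positivity),
    ENNReal.ofReal_sum_of_nonneg fun i _ => measureReal_nonneg]
  simp [Measure.real]

end RandomFeature

/-! ### Least squares as projection, and the projected noise -/

namespace RandomFeature

open scoped ENNReal

section FixedDesign

variable {n N : ℕ}

/-- The linear map `q ↦ (⟨q, F_i⟩)_i` of a design matrix `F`. -/
noncomputable def designMap (F : Fin n → Fin N → ℝ) :
    (Fin N → ℝ) →ₗ[ℝ] EuclideanSpace ℝ (Fin n) where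
  toFun q := WithLp.toLp 2 fun i => ∑ j, q j * F i j
  map_add' q r := by ext i; simp [add_mul, Finset.sum_add_distrib]
  map_smul' c q := by ext i; simp [Finset.mul_sum, mul_assoc]

@[simp] theorem designMap_apply (F : Fin n → Fin N → ℝ) (q : Fin N → ℝ) (i : Fin n) :
    designMap F q i = ∑ j, q j * F i j := rfl

/-- Orthogonal projection onto the column space of a design matrix. -/
noncomputable def hatMap (F : Fin n → Fin N → ℝ) :
    EuclideanSpace ℝ (Fin n) →L[ℝ] EuclideanSpace ℝ (Fin n) :=
  (LinearMap.range (designMap F)).starProjection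

/-- Entries of the orthogonal projection onto the column space of a design matrix. -/
noncomputable def hatEntry (F : Fin n → Fin N → ℝ) (i j : Fin n) : ℝ :=
  inner ℝ (EuclideanSpace.single i (1 : ℝ)) (hatMap F (EuclideanSpace.single j 1))

theorem inner_hatMap_self (F : Fin n → Fin N → ℝ) (v : EuclideanSpace ℝ (Fin n)) :
    inner ℝ v (hatMap F v) = ‖hatMap F v‖ ^ 2 := by
  have h := Submodule.starProjection_inner_eq_zero (K := LinearMap.range (designMap F)) v
    (hatMap F v) (Submodule.starProjection_apply_mem _ _)
  rw [inner_sub_left, sub_eq_zero] at h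
  rw [h, ← real_inner_self_eq_norm_sq]
  rfl

theorem norm_sq_hatMap (F : Fin n → Fin N → ℝ) (v : EuclideanSpace ℝ (Fin n)) :
    ‖hatMap F v‖ ^ 2 = ‖v‖ ^ 2 - ‖v - hatMap F v‖ ^ 2 := by
  rw [norm_sub_sq_real, inner_hatMap_self]
  ring

/-- A least-squares fit is at least as close to any vector `m` as any other fit, up to the
projected noise. -/
theorem norm_sq_fit_sub_le (F : Fin n → Fin N → ℝ) (y m : EuclideanSpace ℝ (Fin n))
    (q : Fin N → ℝ) (hq : ∀ v, ‖designMap F q - y‖ ^ 2 ≤ ‖designMap F v - y‖ ^ 2)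
    (v : Fin N → ℝ) :
    ‖designMap F q - m‖ ^ 2 ≤ ‖designMap F v - m‖ ^ 2 + ‖hatMap F (y - m)‖ ^ 2 := by
  set U := LinearMap.range (designMap F)
  have hU : ∀ w, designMap F w ∈ U := fun w => ⟨w, rfl⟩
  have hPU : ∀ w, hatMap F w ∈ U := fun w => Submodule.starProjection_apply_mem _ _
  have pyth : ∀ (z : EuclideanSpace ℝ (Fin n)) (w), w ∈ U →
      ‖w - z‖ ^ 2 = ‖w - hatMap F z‖ ^ 2 + ‖hatMap F z - z‖ ^ 2 := fun z w hw => by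
    have h := Submodule.starProjection_inner_eq_zero (K := U) z (w - hatMap F z)
      (U.sub_mem hw (hPU z))
    have h' : inner ℝ (w - hatMap F z) (hatMap F z - z) = 0 := by
      rw [real_inner_comm, ← neg_sub z, inner_neg_left, neg_eq_zero]
      exact h
    rw [show w - z = (w - hatMap F z) + (hatMap F z - z) by abel, norm_add_sq_real, h']
    ring
  -- By Pythagoras a minimizer over the column space must be the projection of `y`. Then `P y - m`
  -- splits orthogonally into `P (y - m)` and `P m - m`, and `P m` is the closest fit to `m`.
  have hfit : designMap F q = hatMap F y := by
    obtain ⟨w, hw⟩ := hPU y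
    have h1 := hq w
    rw [hw, pyth y _ (hU q)] at h1
    have : ‖designMap F q - hatMap F y‖ ^ 2 ≤ 0 := by linarith
    exact sub_eq_zero.1 (norm_eq_zero.1 (pow_eq_zero_iff two_ne_zero |>.1
      (le_antisymm this (by positivity))))
  have h2 := pyth m (designMap F q) (hU q)
  have h3 := pyth m (designMap F v) (hU v)
  rw [hfit, ← map_sub] at h2
  rw [hfit, h2, h3]
  nlinarith [sq_nonneg ‖designMap F v - hatMap F m‖]

/-- A projection satisfies `‖P v‖² = ⟨v, P v⟩`, a quadratic form whose coefficients depend on the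
design only. In expectation the noise then enters through products of two coordinates. -/
theorem norm_sq_hatMap_eq_sum (F : Fin n → Fin N → ℝ) (v : EuclideanSpace ℝ (Fin n)) :
    ‖hatMap F v‖ ^ 2 = ∑ i, ∑ j, hatEntry F i j * (v i * v j) := by
  have hv : v = ∑ i, v i • EuclideanSpace.single i (1 : ℝ) := by
    ext k
    simp [Finset.sum_apply, Pi.single_apply]
  rw [← inner_hatMap_self]
  conv_lhs => rw [hv]
  simp only [map_sum, map_smul, sum_inner, inner_sum, real_inner_smul_left, inner_smul_right]
  rw [Finset.sum_comm]
  refine Finset.sum_congr rfl fun i _ => ?_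
  rw [Finset.mul_sum]
  refine Finset.sum_congr rfl fun j _ => ?_
  rw [hatEntry]
  ring

theorem abs_hatEntry_le_one (F : Fin n → Fin N → ℝ) (i j : Fin n) : |hatEntry F i j| ≤ 1 := by
  refine (abs_real_inner_le_norm _ _).trans ?_
  have h := Submodule.norm_starProjection_apply_le (LinearMap.range (designMap F))
    (EuclideanSpace.single j (1 : ℝ))
  have h1 : ‖hatMap F (EuclideanSpace.single j 1)‖ ≤ 1 := h.trans (by simp)
  simpa using h1

theorem hatEntry_self_nonneg (F : Fin n → Fin N → ℝ) (i : Fin n) : 0 ≤ hatEntry F i i := by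
  rw [hatEntry, inner_hatMap_self]
  positivity

/-- The trace of a projection is its rank, here at most the number `N` of columns. -/
theorem sum_hatEntry_self_le (F : Fin n → Fin N → ℝ) : ∑ i, hatEntry F i i ≤ N := by
  set U := LinearMap.range (designMap F)
  have h1 : LinearMap.trace ℝ _ (hatMap F : EuclideanSpace ℝ (Fin n) →ₗ[ℝ] _) =
      (Module.finrank ℝ U : ℝ) :=
    LinearMap.IsProj.trace (p := U)
      ⟨fun x => Submodule.starProjection_apply_mem _ _,
        fun x hx => Submodule.starProjection_eq_self_iff.2 hx⟩
  rw [LinearMap.trace_eq_sum_inner _ (EuclideanSpace.basisFun (Fin n) ℝ)] at h1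
  have h2 : Module.finrank ℝ U ≤ N := by
    simpa using LinearMap.finrank_range_le (designMap F)
  calc _ = (Module.finrank ℝ U : ℝ) := by rw [← h1]; simp [hatEntry]
    _ ≤ N := by exact_mod_cast h2

/-- Polarization, which reduces measurability of the entries to that of the squared norms. -/
theorem hatEntry_eq (F : Fin n → Fin N → ℝ) (i j : Fin n) :
    hatEntry F i j = (‖hatMap F (EuclideanSpace.single i 1 + EuclideanSpace.single j 1)‖ ^ 2 -
      ‖hatMap F (EuclideanSpace.single i 1 - EuclideanSpace.single j 1)‖ ^ 2) / 4 := by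
  have hsymm : inner ℝ (EuclideanSpace.single j (1 : ℝ)) (hatMap F (EuclideanSpace.single i 1)) =
      hatEntry F i j := by
    rw [hatEntry, real_inner_comm]
    exact Submodule.inner_starProjection_left_eq_right _ _ _
  rw [← inner_hatMap_self, ← inner_hatMap_self]
  simp only [map_add, map_sub, inner_add_left, inner_add_right, inner_sub_left, inner_sub_right,
    hsymm]
  rw [show inner ℝ (EuclideanSpace.single i (1 : ℝ)) (hatMap F (EuclideanSpace.single j 1)) =
    hatEntry F i j from rfl]
  ring

/-- The projection jumps with the rank of the design, so continuity is not available. The distance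
to the column space is, however, an infimum of `‖v - F q‖` over a countable dense set of `q`, and
`‖P v‖²` is `‖v‖²` minus its square. -/
theorem measurable_norm_hatMap {α : Type*} [MeasurableSpace α] (F : α → Fin n → Fin N → ℝ)
    (hF : Measurable F) (v : EuclideanSpace ℝ (Fin n)) :
    Measurable fun a => ‖hatMap (F a) v‖ ^ 2 := by
  simp_rw [norm_sq_hatMap]
  refine measurable_const.sub (Measurable.pow_const ?_ 2)
  refine measurable_of_Iio fun r => ?_
  obtain ⟨w, hw⟩ := TopologicalSpace.exists_dense_seq (Fin N → ℝ)
  have hset : (fun a => ‖v - hatMap (F a) v‖) ⁻¹' Set.Iio r =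
      ⋃ k, {a | ‖v - designMap (F a) (w k)‖ < r} := by
    ext a
    simp only [Set.mem_preimage, Set.mem_Iio, Set.mem_iUnion, Set.mem_ofPred_eq]
    constructor
    · intro h
      obtain ⟨q, hq⟩ : hatMap (F a) v ∈ LinearMap.range (designMap (F a)) :=
        Submodule.starProjection_apply_mem _ _
      have hopen : IsOpen {q : Fin N → ℝ | ‖v - designMap (F a) q‖ < r} :=
        isOpen_lt (continuous_const.sub
          (LinearMap.continuous_of_finiteDimensional _)).norm continuous_const
      obtain ⟨k, hk⟩ := hw.exists_mem_open hopen ⟨q, by simpa [hq] using h⟩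
      exact ⟨k, hk⟩
    · rintro ⟨k, hk⟩
      refine lt_of_le_of_lt ?_ hk
      rw [hatMap, Submodule.starProjection_minimal]
      exact ciInf_le ⟨0, by rintro _ ⟨x, rfl⟩; exact norm_nonneg _⟩
        (⟨designMap (F a) (w k), ⟨_, rfl⟩⟩ : LinearMap.range (designMap (F a)))
  rw [hset]
  refine MeasurableSet.iUnion fun k => measurableSet_lt (Measurable.norm ?_) measurable_const
  refine measurable_const.sub ?_
  refine (WithLp.measurable_toLp 2 (Fin n → ℝ)).comp (measurable_pi_lambda _ fun i => ?_)
  exact Finset.measurable_sum _ fun j _ => measurable_const.mul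
    ((measurable_pi_apply j).comp ((measurable_pi_apply i).comp hF))

theorem measurable_hatEntry {α : Type*} [MeasurableSpace α] (F : α → Fin n → Fin N → ℝ)
    (hF : Measurable F) (i j : Fin n) : Measurable fun a => hatEntry (F a) i j := by
  simp_rw [hatEntry_eq]
  exact ((measurable_norm_hatMap F hF _).sub (measurable_norm_hatMap F hF _)).div_const 4

end FixedDesign

/-- `ρ` is the law of a regression pair with regression function `m` and conditional noise variance
at most `σ²`. -/
structure IsRegressionLaw {𝒳 : Type*} [MeasurableSpace 𝒳] (ρ : Measure (𝒳 × ℝ)) (m : 𝒳 → ℝ)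
    (σ : ℝ) : Prop where
  measurable : Measurable m
  integrable_sq : Integrable (fun z => (z.2 - m z.1) ^ 2) ρ
  integral_noise : ∀ h : 𝒳 → ℝ, Measurable h → (∀ x, |h x| ≤ 1) →
    ∫ z, h z.1 * (z.2 - m z.1) ∂ρ = 0
  integral_noise_sq : ∀ h : 𝒳 → ℝ, Measurable h → (∀ x, |h x| ≤ 1) → (∀ x, 0 ≤ h x) →
    ∫ z, h z.1 * (z.2 - m z.1) ^ 2 ∂ρ ≤ σ ^ 2 * ∫ z, h z.1 ∂ρ

namespace IsRegressionLaw

variable {𝒳 : Type*} [MeasurableSpace 𝒳] {ρ : Measure (𝒳 × ℝ)}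
  {m : 𝒳 → ℝ} {σ : ℝ} {n : ℕ}

theorem measurable_noise (hρ : IsRegressionLaw ρ m σ) : Measurable fun z : 𝒳 × ℝ => z.2 - m z.1 :=
  measurable_snd.sub (hρ.measurable.comp measurable_fst)

variable [IsProbabilityMeasure ρ]

theorem integrable_mul_noise (hρ : IsRegressionLaw ρ m σ) (p : (Fin n → 𝒳) → ℝ) (hp : Measurable p)
    (hp1 : ∀ x, |p x| ≤ 1) (i j : Fin n) :
    Integrable (fun z : Fin n → 𝒳 × ℝ => p (fun k => (z k).1) *
      (((z i).2 - m (z i).1) * ((z j).2 - m (z j).1))) (Measure.pi fun _ => ρ) := by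
  have hsq : ∀ i, Integrable (fun z : Fin n → 𝒳 × ℝ => ((z i).2 - m (z i).1) ^ 2)
      (Measure.pi fun _ => ρ) := fun i =>
    (measurePreserving_eval (fun _ : Fin n => ρ) i).integrable_comp_of_integrable hρ.integrable_sq
  have hme : ∀ i, Measurable (fun z : Fin n → 𝒳 × ℝ => (z i).2 - m (z i).1) := fun i =>
    hρ.measurable_noise.comp (measurable_pi_apply i)
  refine ((hsq i).add (hsq j)).mono' (Measurable.aestronglyMeasurable ?_) (ae_of_all _ fun z => ?_)
  · exact (hp.comp (by fun_prop)).mul ((hme i).mul (hme j))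
  · rw [Real.norm_eq_abs, abs_mul, abs_mul]
    set a := (z i).2 - m (z i).1
    set b := (z j).2 - m (z j).1
    calc _ ≤ 1 * (|a| * |b|) := by gcongr; exact hp1 _
      _ ≤ a ^ 2 + b ^ 2 := by
        nlinarith [sq_nonneg (|a| - |b|), sq_abs a, sq_abs b, sq_nonneg a, sq_nonneg b]

/-- Fubini with all observations but the `i`-th held fixed: the weight becomes a bounded function of
the `i`-th input and the `j`-th noise a constant, so the inner integral is a test of the centred
noise. -/
theorem integral_mul_noise_of_ne (hρ : IsRegressionLaw ρ m σ) (p : (Fin n → 𝒳) → ℝ)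
    (hp : Measurable p) (hp1 : ∀ x, |p x| ≤ 1) (i j : Fin n) (hij : i ≠ j) :
    ∫ z : Fin n → 𝒳 × ℝ, p (fun k => (z k).1) *
      (((z i).2 - m (z i).1) * ((z j).2 - m (z j).1)) ∂(Measure.pi fun _ => ρ) = 0 := by
  obtain ⟨n, rfl⟩ : ∃ k, n = k + 1 := ⟨n - 1, by have := i.pos; omega⟩
  obtain ⟨j, rfl⟩ := Fin.exists_succAbove_eq hij.symm
  have hmp := (measurePreserving_piFinSuccAbove (fun _ : Fin (n + 1) => ρ) i).symm
  have hint := hρ.integrable_mul_noise p hp hp1 i (i.succAbove j)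
  rw [← hmp.integrable_comp_emb (MeasurableEquiv.measurableEmbedding _), Function.comp_def] at hint
  rw [← hmp.integral_comp (MeasurableEquiv.measurableEmbedding _), integral_prod_symm _ hint]
  refine integral_eq_zero_of_ae (ae_of_all _ fun r => ?_)
  have h0 := hρ.integral_noise
    (fun x => p (i.insertNth x fun k => (r k).1))
    (hp.comp (measurable_pi_iff.2 <| i.forall_iff_succAbove.2
      ⟨by simp [measurable_id'], fun k => by simp⟩)) (fun x => hp1 _)
  calc _ = ∫ z, ((r j).2 - m (r j).1) * (p (i.insertNth z.1 fun k => (r k).1) *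
        (z.2 - m z.1)) ∂ρ := by
        refine integral_congr_ae (ae_of_all _ fun z => ?_)
        have e1 : (fun k => ((i.insertNth z r : Fin (n + 1) → 𝒳 × ℝ) k).1) =
            i.insertNth z.1 fun k => (r k).1 := by
          funext k
          refine Fin.succAboveCases i ?_ (fun k => ?_) k <;> simp
        simp [MeasurableEquiv.piFinSuccAbove, Fin.insertNthEquiv, e1]
        ring
    _ = 0 := by rw [integral_const_mul, h0, mul_zero]

theorem integral_mul_noise_sq_le (hρ : IsRegressionLaw ρ m σ) (p : (Fin n → 𝒳) → ℝ)
    (hp : Measurable p) (hp1 : ∀ x, |p x| ≤ 1) (hp0 : ∀ x, 0 ≤ p x) (i : Fin n) :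
    ∫ z : Fin n → 𝒳 × ℝ, p (fun k => (z k).1) *
      (((z i).2 - m (z i).1) * ((z i).2 - m (z i).1)) ∂(Measure.pi fun _ => ρ) ≤
      σ ^ 2 * ∫ z : Fin n → 𝒳 × ℝ, p (fun k => (z k).1) ∂(Measure.pi fun _ => ρ) := by
  obtain ⟨n, rfl⟩ : ∃ k, n = k + 1 := ⟨n - 1, by have := i.pos; omega⟩
  have hmp := (measurePreserving_piFinSuccAbove (fun _ : Fin (n + 1) => ρ) i).symm
  have hint := hρ.integrable_mul_noise p hp hp1 i i
  have hpint : Integrable (fun z : Fin (n + 1) → 𝒳 × ℝ => p (fun k => (z k).1))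
      (Measure.pi fun _ => ρ) :=
    Integrable.of_bound (hp.comp (by fun_prop)).aestronglyMeasurable 1 (ae_of_all _ fun z => hp1 _)
  rw [← hmp.integrable_comp_emb (MeasurableEquiv.measurableEmbedding _),
    Function.comp_def] at hint hpint
  rw [← hmp.integral_comp (MeasurableEquiv.measurableEmbedding _), integral_prod_symm _ hint,
    ← hmp.integral_comp (MeasurableEquiv.measurableEmbedding _), integral_prod_symm _ hpint,
    ← integral_const_mul]
  refine integral_mono hint.integral_prod_right (hpint.integral_prod_right.const_mul _) fun r => ?_
  have e1 : ∀ z : 𝒳 × ℝ, (fun k => ((i.insertNth z r : Fin (n + 1) → 𝒳 × ℝ) k).1) =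
      i.insertNth z.1 fun k => (r k).1 := fun z => by
    funext k
    refine Fin.succAboveCases i ?_ (fun k => ?_) k <;> simp
  have h0 := hρ.integral_noise_sq
    (fun x => p (i.insertNth x fun k => (r k).1))
    (hp.comp (measurable_pi_iff.2 <| i.forall_iff_succAbove.2
      ⟨by simp [measurable_id'], fun k => by simp⟩)) (fun x => hp1 _) (fun x => hp0 _)
  simpa [MeasurableEquiv.piFinSuccAbove, Fin.insertNthEquiv, e1, ← sq] using h0

/-- The projected noise has second moment at most `σ² N`. -/
theorem lintegral_norm_sq_hatMap_le (hρ : IsRegressionLaw ρ m σ) {N : ℕ} (φ : 𝒳 → Fin N → ℝ)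
    (hφ : Measurable φ) :
    ∫⁻ z : Fin n → 𝒳 × ℝ, ENNReal.ofReal (‖hatMap (fun i => φ (z i).1)
      (WithLp.toLp 2 fun i => (z i).2 - m (z i).1)‖ ^ 2) ∂(Measure.pi fun _ => ρ) ≤
      ENNReal.ofReal (σ ^ 2 * N) := by
  set P : Fin n → Fin n → (Fin n → 𝒳) → ℝ := fun i j x => hatEntry (fun k => φ (x k)) i j
  have hP : ∀ i j, Measurable (P i j) := fun i j =>
    measurable_hatEntry (fun x : Fin n → 𝒳 => fun k => φ (x k)) (by fun_prop) i j
  have hP1 : ∀ i j x, |P i j x| ≤ 1 := fun i j x => abs_hatEntry_le_one _ i j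
  have hPint : ∀ i j, Integrable (fun z : Fin n → 𝒳 × ℝ => P i j fun k => (z k).1)
      (Measure.pi fun _ => ρ) := fun i j =>
    Integrable.of_bound ((hP i j).comp (by fun_prop)).aestronglyMeasurable 1
      (ae_of_all _ fun z => hP1 i j _)
  have hint := fun i j => hρ.integrable_mul_noise (P i j) (hP i j) (hP1 i j) i j
  have heq : ∀ z : Fin n → 𝒳 × ℝ, ‖hatMap (fun i => φ (z i).1)
      (WithLp.toLp 2 fun i => (z i).2 - m (z i).1)‖ ^ 2 =
      ∑ i, ∑ j, P i j (fun k => (z k).1) * (((z i).2 - m (z i).1) * ((z j).2 - m (z j).1)) :=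
    fun z => norm_sq_hatMap_eq_sum _ _
  have hall : Integrable (fun z : Fin n → 𝒳 × ℝ => ‖hatMap (fun i => φ (z i).1)
      (WithLp.toLp 2 fun i => (z i).2 - m (z i).1)‖ ^ 2) (Measure.pi fun _ => ρ) := by
    simp_rw [heq]
    exact integrable_finsetSum _ fun i _ => integrable_finsetSum _ fun j _ => hint i j
  rw [← ofReal_integral_eq_lintegral_ofReal hall (ae_of_all _ fun z => by positivity)]
  refine ENNReal.ofReal_le_ofReal ?_
  simp_rw [heq]
  rw [integral_finsetSum _ fun i _ => integrable_finsetSum _ fun j _ => hint i j]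
  -- Off-diagonal terms vanish; the diagonal weights are nonnegative, at most 1, and sum to at most
  -- `N`.
  calc _ ≤ ∑ i, σ ^ 2 * ∫ z : Fin n → 𝒳 × ℝ, P i i (fun k => (z k).1) ∂(Measure.pi fun _ => ρ) := by
        refine Finset.sum_le_sum fun i _ => ?_
        rw [integral_finsetSum _ fun j _ => hint i j, Finset.sum_eq_single i]
        · exact hρ.integral_mul_noise_sq_le (P i i) (hP i i) (hP1 i i)
            (fun x => hatEntry_self_nonneg _ i) i
        · exact fun j _ hj => hρ.integral_mul_noise_of_ne (P i j) (hP i j) (hP1 i j) i j hj.symm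
        · simp
    _ = σ ^ 2 * ∫ z : Fin n → 𝒳 × ℝ, ∑ i, P i i (fun k => (z k).1) ∂(Measure.pi fun _ => ρ) := by
        rw [integral_finsetSum _ fun i _ => hPint i i, Finset.mul_sum]
    _ ≤ σ ^ 2 * ∫ z : Fin n → 𝒳 × ℝ, (N : ℝ) ∂(Measure.pi fun _ => ρ) := by
        refine mul_le_mul_of_nonneg_left ?_ (sq_nonneg σ)
        exact integral_mono (integrable_finsetSum _ fun i _ => hPint i i) (integrable_const _)
          fun z => sum_hatEntry_self_le _
    _ = σ ^ 2 * N := by simp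

end IsRegressionLaw

end RandomFeature

/-! ### The oracle inequality -/

namespace RandomFeature

open scoped ENNReal

theorem abs_truncate_le {L : ℝ} (hL : 0 ≤ L) (u : ℝ) : |truncate L u| ≤ L := by
  rw [abs_le, truncate]
  exact ⟨le_max_right _ _, max_le (min_le_right _ _) (by linarith)⟩

theorem measurable_truncate (L : ℝ) : Measurable (truncate L) :=
  (measurable_id.min measurable_const).max measurable_const

/-- Truncation is the nearest-point map onto `[-L, L]`, which contains `m`. -/
theorem sq_sub_truncate_le {L m : ℝ} (hm : |m| ≤ L) (u : ℝ) :
    (m - truncate L u) ^ 2 ≤ (m - u) ^ 2 := by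
  rw [abs_le] at hm
  rw [sq_le_sq, truncate]
  rcases le_total u L with h1 | h1
  · rw [min_eq_left h1]
    rcases le_total u (-L) with h2 | h2
    · rw [max_eq_right h2, abs_of_nonneg (by linarith), abs_of_nonneg (by linarith)]
      linarith
    · rw [max_eq_left h2]
  · rw [min_eq_right h1, max_eq_left (by linarith), abs_of_nonpos (by linarith),
      abs_of_nonpos (by linarith)]
    linarith

theorem sq_sub_truncate_le_four_mul {L m : ℝ} (hL : 0 ≤ L) (hm : |m| ≤ L) (u : ℝ) :
    (m - truncate L u) ^ 2 ≤ 4 * L ^ 2 := by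
  have h1 := abs_le.1 (abs_truncate_le hL u)
  rw [abs_le] at hm
  nlinarith

section TruncatedClass

variable {𝒳 : Type*} {n N : ℕ}

theorem card_pairTraces_truncated_le (φ : 𝒳 → Fin N → ℝ) (m : 𝒳 → ℝ) (L t : ℝ) (ht : 0 ≤ t)
    (u : Fin n → (𝒳 × ℝ) × (𝒳 × ℝ)) :
    (pairTraces (fun q : Fin N → ℝ =>
      {z : 𝒳 × ℝ | t < (m z.1 - truncate L (∑ j, q j * φ z.1 j)) ^ 2}) u).card ≤
      (2 * n + 1) ^ (2 * N) := by
  classical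
  let pt : Fin n × Bool → 𝒳 := fun p => if p.2 then (u p.1).2.1 else (u p.1).1.1
  have h := card_truncated_traces_le (fun p => φ (pt p)) (fun p => m (pt p)) L t ht
  set R := Set.range fun (q : Fin N → ℝ) (p : Fin n × Bool) =>
      decide (t < (m (pt p) - truncate L (∑ j, q j * φ (pt p) j)) ^ 2)
  let f : (Fin n × Bool → Bool) → Fin n → Bool × Bool := fun τ i => (τ (i, false), τ (i, true))
  rw [pairTraces, ← Set.ncard_eq_toFinset_card]
  have hsub : Set.range (pairTrace (fun q : Fin N → ℝ =>
      {z : 𝒳 × ℝ | t < (m z.1 - truncate L (∑ j, q j * φ z.1 j)) ^ 2}) u) ⊆ f '' R := by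
    rintro _ ⟨q, rfl⟩
    refine ⟨_, ⟨q, rfl⟩, ?_⟩
    funext i
    simp [f, pt, pairTrace]
  calc _ ≤ (f '' R).ncard := Set.ncard_le_ncard hsub (Set.toFinite _)
    _ ≤ R.ncard := Set.ncard_image_le (Set.toFinite _)
    _ ≤ _ := h
    _ = _ := by simp [mul_comm]

/-- The expected squared error of a truncated data-dependent linear predictor is at most twice its
expected empirical squared error plus a complexity term. -/
theorem lintegral_sq_sub_truncate_le [MeasurableSpace 𝒳] (hn : n ≠ 0) (ρ : Measure (𝒳 × ℝ))
    [IsProbabilityMeasure ρ] {m : 𝒳 → ℝ} (hm : Measurable m) {L : ℝ} (hL : 0 ≤ L)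
    (hmL : ∀ x, |m x| ≤ L) (φ : 𝒳 → Fin N → ℝ) (hφ : Measurable φ)
    (w : (Fin n → 𝒳 × ℝ) → Fin N → ℝ) (hw : Measurable w) :
    ∫⁻ p : (Fin n → 𝒳 × ℝ) × (𝒳 × ℝ), ENNReal.ofReal
      ((m p.2.1 - truncate L (∑ j, w p.1 j * φ p.2.1 j)) ^ 2) ∂((Measure.pi fun _ => ρ).prod ρ) ≤
    ENNReal.ofReal (2 / n) * ∑ i, ∫⁻ z : Fin n → 𝒳 × ℝ, ENNReal.ofReal
      ((m (z i).1 - truncate L (∑ j, w z j * φ (z i).1 j)) ^ 2) ∂(Measure.pi fun _ => ρ) +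
    ENNReal.ofReal (4 * L ^ 2 * (2 * N * Real.log (2 * n + 1) / (n * Real.log (3 / 2)))) := by
  set μ : Measure (Fin n → 𝒳 × ℝ) := Measure.pi fun _ => ρ
  set g : (Fin n → 𝒳 × ℝ) × (𝒳 × ℝ) → ℝ := fun p =>
    (m p.2.1 - truncate L (∑ j, w p.1 j * φ p.2.1 j)) ^ 2
  have hg : Measurable g := by
    refine Measurable.pow_const (Measurable.sub (hm.comp (by fun_prop)) ?_) 2
    exact (measurable_truncate L).comp (Finset.measurable_sum _ fun j _ =>
      ((measurable_pi_apply j).comp (hw.comp measurable_fst)).mul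
      ((measurable_pi_apply j).comp (hφ.comp (by fun_prop))))
  have hgi : ∀ i, Measurable fun z : Fin n → 𝒳 × ℝ => g (z, z i) := fun i =>
    hg.comp (by fun_prop)
  have hg0 : ∀ p, 0 ≤ g p := fun p => sq_nonneg _
  have hgL : ∀ p, g p ≤ 4 * L ^ 2 := fun p => sq_sub_truncate_le_four_mul hL (hmL _) _
  change ∫⁻ p, ENNReal.ofReal (g p) ∂(μ.prod ρ) ≤ ENNReal.ofReal (2 / n) *
    ∑ i, ∫⁻ z, ENNReal.ofReal (g (z, z i)) ∂μ + _
  -- Layer cake: the deviation inequality for sets is applied at each level and integrated.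
  rw [lintegral_eq_lintegral_meas_lt _ (ae_of_all _ hg0) hg.aemeasurable]
  simp_rw [fun i => lintegral_eq_lintegral_meas_lt μ (ae_of_all _ fun z => hg0 (z, z i))
    (hgi i).aemeasurable]
  set c := 2 * N * Real.log (2 * n + 1) / (n * Real.log (3 / 2))
  have hmeasi : ∀ i, Measurable fun t : ℝ => μ {z | t < g (z, z i)} := fun i =>
    Antitone.measurable fun s t hst => measure_mono fun z (hz : t < _) => hst.trans_lt hz
  -- Above `4 L²` the level sets are empty, so the complexity term is integrated only over an
  -- interval of length `4 L²`.
  have hlt : ∀ t ∈ Set.Ioi (0 : ℝ), (μ.prod ρ) {p | t < g p} ≤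
      ENNReal.ofReal (2 / n) * ∑ i, μ {z | t < g (z, z i)} +
      (Set.Iio (4 * L ^ 2)).indicator (fun _ => ENNReal.ofReal c) t := fun t ht => by
    by_cases htL : t < 4 * L ^ 2
    · rw [Set.indicator_of_mem (by exact htL)]
      have := measure_le_two_mul_empirical_add hn ρ
        (fun q : Fin N → ℝ => {z : 𝒳 × ℝ | t < (m z.1 - truncate L (∑ j, q j * φ z.1 j)) ^ 2}) w
        (measurableSet_lt measurable_const hg) _
        (fun u => card_pairTraces_truncated_le φ m L t (le_of_lt ht) u)
      have hcT : Real.log ((2 * n + 1) ^ (2 * N) : ℕ) / (n * Real.log (3 / 2)) = c := by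
        push_cast
        rw [Real.log_pow]
        push_cast
        rfl
      rw [hcT] at this
      exact this
    · have : {p | t < g p} = ∅ := by
        ext p
        simpa using (hgL p).trans (not_lt.1 htL)
      simp [this]
  calc _ ≤ ∫⁻ t in Set.Ioi 0, (ENNReal.ofReal (2 / n) * ∑ i, μ {z | t < g (z, z i)} +
        (Set.Iio (4 * L ^ 2)).indicator (fun _ => ENNReal.ofReal c) t) :=
        setLIntegral_mono' measurableSet_Ioi hlt
    _ = ENNReal.ofReal (2 / n) * (∑ i, ∫⁻ t in Set.Ioi 0, μ {z | t < g (z, z i)}) +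
        ∫⁻ t in Set.Ioi 0, (Set.Iio (4 * L ^ 2)).indicator (fun _ => ENNReal.ofReal c) t := by
        rw [lintegral_add_left ((Finset.measurable_sum _ fun i _ => hmeasi i).const_mul _),
          lintegral_const_mul _ (Finset.measurable_sum _ fun i _ => hmeasi i),
          lintegral_finsetSum _ fun i _ => hmeasi i]
    _ = _ := by
        congr 1
        rw [lintegral_indicator measurableSet_Iio, Measure.restrict_restrict measurableSet_Iio,
          setLIntegral_const, Set.Iio_inter_Ioi, Real.volume_Ioo, sub_zero,
          ENNReal.ofReal_mul (by positivity : 0 ≤ 4 * L ^ 2), mul_comm]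

/-- **Oracle inequality** for truncated least squares over an `N`-dimensional linear class. -/
theorem IsRegressionLaw.lintegral_sq_sub_truncate_leastSquares_le [MeasurableSpace 𝒳] (hn : n ≠ 0)
    {ρ : Measure (𝒳 × ℝ)} [IsProbabilityMeasure ρ] {m : 𝒳 → ℝ} {σ : ℝ}
    (hρ : IsRegressionLaw ρ m σ) {L : ℝ} (hL : 0 ≤ L)
    (hmL : ∀ x, |m x| ≤ L) (φ : 𝒳 → Fin N → ℝ) (hφ : Measurable φ)
    (w : (Fin n → 𝒳 × ℝ) → Fin N → ℝ) (hw : Measurable w)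
    (hmin : ∀ᵐ z ∂(Measure.pi fun _ : Fin n => ρ), ∀ v : Fin N → ℝ,
      ∑ i, (∑ j, w z j * φ (z i).1 j - (z i).2) ^ 2 ≤ ∑ i, (∑ j, v j * φ (z i).1 j - (z i).2) ^ 2)
    (v : Fin N → ℝ) :
    ∫⁻ p : (Fin n → 𝒳 × ℝ) × (𝒳 × ℝ), ENNReal.ofReal
      ((m p.2.1 - truncate L (∑ j, w p.1 j * φ p.2.1 j)) ^ 2) ∂((Measure.pi fun _ => ρ).prod ρ) ≤
    2 * ∫⁻ z, ENNReal.ofReal ((m z.1 - ∑ j, v j * φ z.1 j) ^ 2) ∂ρ +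
    ENNReal.ofReal (2 * σ ^ 2 * N / n +
      4 * L ^ 2 * (2 * N * Real.log (2 * n + 1) / (n * Real.log (3 / 2)))) := by
  have hm := hρ.measurable
  have hlog : 0 ≤ Real.log (2 * n + 1) := Real.log_nonneg (by
    have : (0 : ℝ) ≤ n := by positivity
    linarith)
  have hlog' : 0 < Real.log (3 / 2) := Real.log_pos (by norm_num)
  set μ : Measure (Fin n → 𝒳 × ℝ) := Measure.pi fun _ => ρ
  have hgen : ∀ q : (Fin n → 𝒳 × ℝ) → Fin N → ℝ, Measurable q → ∀ i : Fin n,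
      Measurable fun z : Fin n → 𝒳 × ℝ => ∑ j, q z j * φ (z i).1 j := fun q hq i =>
    Finset.measurable_sum _ fun j _ => ((measurable_pi_apply j).comp hq).mul
      ((measurable_pi_apply j).comp (hφ.comp (by fun_prop)))
  have hmi : ∀ i, Measurable fun z : Fin n → 𝒳 × ℝ => m (z i).1 := fun i => hm.comp (by fun_prop)
  have hvm : Measurable fun z : 𝒳 × ℝ => ENNReal.ofReal ((m z.1 - ∑ j, v j * φ z.1 j) ^ 2) := by
    refine ENNReal.measurable_ofReal.comp (Measurable.pow_const (Measurable.sub ?_ ?_) 2)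
    · exact hm.comp measurable_fst
    · exact Finset.measurable_sum _ fun j _ => measurable_const.mul
        ((measurable_pi_apply j).comp (hφ.comp measurable_fst))
  refine (lintegral_sq_sub_truncate_le hn ρ hm hL hmL φ hφ w hw).trans ?_
  have hemp : ∑ i, ∫⁻ z : Fin n → 𝒳 × ℝ, ENNReal.ofReal
      ((m (z i).1 - truncate L (∑ j, w z j * φ (z i).1 j)) ^ 2) ∂μ ≤
      n * ∫⁻ z, ENNReal.ofReal ((m z.1 - ∑ j, v j * φ z.1 j) ^ 2) ∂ρ +
        ENNReal.ofReal (σ ^ 2 * N) := by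
    rw [← lintegral_finsetSum (f := fun i z => ENNReal.ofReal
        ((m (z i).1 - truncate L (∑ j, w z j * φ (z i).1 j)) ^ 2)) _ fun i _ =>
      ENNReal.measurable_ofReal.comp
      (((hmi i).sub ((measurable_truncate L).comp (hgen w hw i))).pow_const 2)]
    -- Truncation does not increase the error, and the projection inequality holds sample by sample;
    -- expectations are taken afterwards.
    have hpt : ∀ᵐ z ∂μ, ∑ i, ENNReal.ofReal
        ((m (z i).1 - truncate L (∑ j, w z j * φ (z i).1 j)) ^ 2) ≤
        ∑ i, ENNReal.ofReal ((m (z i).1 - ∑ j, v j * φ (z i).1 j) ^ 2) +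
        ENNReal.ofReal (‖hatMap (fun i => φ (z i).1)
          (WithLp.toLp 2 fun i => (z i).2 - m (z i).1)‖ ^ 2) := by
      filter_upwards [hmin] with z hz
      have key := norm_sq_fit_sub_le (fun i => φ (z i).1) (WithLp.toLp 2 fun i => (z i).2)
        (WithLp.toLp 2 fun i => m (z i).1) (w z)
        (fun q => by simpa [EuclideanSpace.norm_sq_eq] using hz q) v
      simp only [EuclideanSpace.norm_sq_eq, PiLp.sub_apply, designMap_apply, Real.norm_eq_abs,
        sq_abs] at key
      rw [← ENNReal.ofReal_sum_of_nonneg fun i _ => sq_nonneg _,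
        ← ENNReal.ofReal_sum_of_nonneg fun i _ => sq_nonneg _,
        ← ENNReal.ofReal_add (Finset.sum_nonneg fun i _ => sq_nonneg _) (sq_nonneg _)]
      refine ENNReal.ofReal_le_ofReal ?_
      calc _ ≤ ∑ i, (∑ j, w z j * φ (z i).1 j - m (z i).1) ^ 2 :=
            Finset.sum_le_sum fun i _ => (sq_sub_truncate_le (hmL _) _).trans_eq (by ring)
        _ ≤ _ := key
        _ = _ := by
            congr 1
            · exact Finset.sum_congr rfl fun i _ => by ring
            · simp only [EuclideanSpace.norm_sq_eq, Real.norm_eq_abs, sq_abs]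
              rfl
    have hmv : ∀ i ∈ Finset.univ, Measurable fun z : Fin n → 𝒳 × ℝ =>
        ENNReal.ofReal ((m (z i).1 - ∑ j, v j * φ (z i).1 j) ^ 2) := fun i _ =>
      ENNReal.measurable_ofReal.comp
        (((hmi i).sub (hgen (fun _ => v) measurable_const i)).pow_const 2)
    refine (lintegral_mono_ae hpt).trans ?_
    rw [lintegral_add_left (Finset.measurable_sum _ hmv)]
    refine add_le_add (le_of_eq ?_) (hρ.lintegral_norm_sq_hatMap_le φ hφ)
    rw [lintegral_finsetSum _ hmv]
    have : ∀ i, ∫⁻ z : Fin n → 𝒳 × ℝ, ENNReal.ofReal ((m (z i).1 - ∑ j, v j * φ (z i).1 j) ^ 2) ∂μ =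
        ∫⁻ z, ENNReal.ofReal ((m z.1 - ∑ j, v j * φ z.1 j) ^ 2) ∂ρ := fun i =>
      (measurePreserving_eval (fun _ : Fin n => ρ) i).lintegral_comp hvm
    simp [this]
  calc _ ≤ ENNReal.ofReal (2 / n) *
        (n * ∫⁻ z, ENNReal.ofReal ((m z.1 - ∑ j, v j * φ z.1 j) ^ 2) ∂ρ +
        ENNReal.ofReal (σ ^ 2 * N)) + _ := by gcongr
    _ = _ := by
      have hn' : (0 : ℝ) < n := by positivity
      have h2 : ENNReal.ofReal (2 / n) * n = 2 := by
        rw [← ENNReal.ofReal_natCast, ← ENNReal.ofReal_mul (by positivity)]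
        simp [hn'.ne']
      rw [mul_add, ← mul_assoc, h2, ← ENNReal.ofReal_mul (by positivity), add_assoc,
        ← ENNReal.ofReal_add (by positivity) (by positivity)]
      congr 3
      ring

end TruncatedClass

end RandomFeature

/-! ### Plane wave representation of the target -/

namespace RandomFeature

open scoped ENNReal FourierTransform SchwartzMap ContDiff Manifold

section CharFunRepresentation

variable {E : Type*} [NormedAddCommGroup E] [InnerProductSpace ℝ E] [FiniteDimensional ℝ E]
  [MeasurableSpace E] [BorelSpace E]

theorem integrable_rexp_neg_mul_sq_norm {b : ℝ} (hb : 0 < b) :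
    Integrable fun v : E => Real.exp (-b * ‖v‖ ^ 2) := by
  have h := (GaussianFourier.integrable_cexp_neg_mul_sq_norm_add (V := E)
    (b := (b : ℂ)) (by simpa using hb) 0 0).norm
  refine h.congr (ae_of_all _ fun v => ?_)
  simp [Complex.norm_exp, ← Complex.ofReal_pow]

/-- The mean of a translate of a Schwartz function in terms of its Fourier transform and of the
characteristic function. -/
theorem integral_schwartz_comp_add (μ : Measure E) [IsProbabilityMeasure μ] (g : 𝓢(E, ℂ)) (x : E) :
    ∫ v, g (x + v) ∂μ = ∫ ξ, 𝓕 (g : E → ℂ) ξ *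
      (Complex.exp ((2 * Real.pi * inner ℝ ξ x : ℝ) * Complex.I) *
        charFun μ ((2 * Real.pi) • ξ)) := by
  have hFint : Integrable (𝓕 (g : E → ℂ)) := (𝓕 g).integrable
  have hinv : ∀ y, g y = ∫ ξ, 𝓕 (g : E → ℂ) ξ *
      Complex.exp ((2 * Real.pi * inner ℝ ξ y : ℝ) * Complex.I) := fun y => by
    conv_lhs => rw [← g.continuous.fourierInv_fourier_eq g.integrable hFint,
      Real.fourierInv_eq']
    simp [mul_comm]
  simp_rw [hinv]
  rw [integral_integral_swap]
  · refine integral_congr_ae (ae_of_all _ fun ξ => ?_)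
    simp only [inner_add_right, mul_add, Complex.ofReal_add, add_mul, Complex.exp_add]
    rw [integral_const_mul, integral_const_mul, charFun_apply]
    congr 3
    funext v
    rw [inner_smul_right, real_inner_comm]
  · have h1 : Integrable (fun p : E × E => 𝓕 (g : E → ℂ) p.2) (μ.prod volume) :=
      hFint.comp_snd μ
    refine h1.mono ?_ (ae_of_all _ fun p => ?_)
    · refine h1.aestronglyMeasurable.mul (Continuous.aestronglyMeasurable ?_)
      fun_prop
    · simp only [Function.uncurry, norm_mul, Complex.norm_exp_ofReal_mul_I, mul_one, le_refl]

/-- The Fourier-side functional representing `g ↦ ∫ g (x + v) dμ(v)`. -/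
noncomputable def charFunIntegral (μ : Measure E) (g : E → ℂ) (x : E) : ℂ :=
  ∫ ξ, 𝓕 g ξ * (Complex.exp ((2 * Real.pi * inner ℝ ξ x : ℝ) * Complex.I) *
    charFun μ ((2 * Real.pi) • ξ))

theorem norm_fourier_le (g : E → ℂ) (ξ : E) : ‖𝓕 g ξ‖ ≤ ∫ v, ‖g v‖ :=
  VectorFourier.norm_fourierIntegral_le_integral_norm _ _ _ _ _

theorem norm_charFunIntegrand_le (μ : Measure E) (g : E → ℂ) (x ξ : E) :
    ‖𝓕 g ξ * (Complex.exp ((2 * Real.pi * inner ℝ ξ x : ℝ) * Complex.I) *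
      charFun μ ((2 * Real.pi) • ξ))‖ ≤ (∫ v, ‖g v‖) * ‖charFun μ ((2 * Real.pi) • ξ)‖ := by
  rw [norm_mul, norm_mul, Complex.norm_exp_ofReal_mul_I, one_mul]
  gcongr
  exact norm_fourier_le g ξ

variable {μ : Measure E}

theorem integrable_norm_charFun_smul (hμ : Integrable (charFun μ)) :
    Integrable fun ξ : E => ‖charFun μ ((2 * Real.pi) • ξ)‖ :=
  (hμ.comp_smul (by positivity : (2 * Real.pi) ≠ 0)).norm

theorem continuous_fourier {g : E → ℂ} (hg : Integrable g) : Continuous (𝓕 g) :=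
  VectorFourier.fourierIntegral_continuous Real.continuous_fourierChar
    (by simpa using continuous_inner) hg

theorem norm_charFunIntegral_le (hμ : Integrable (charFun μ)) (g : E → ℂ) (x : E) :
    ‖charFunIntegral μ g x‖ ≤ (∫ v, ‖g v‖) * ∫ ξ, ‖charFun μ ((2 * Real.pi) • ξ)‖ := by
  rw [← integral_const_mul]
  exact norm_integral_le_of_norm_le ((integrable_norm_charFun_smul hμ).const_mul _)
    (ae_of_all _ fun ξ => norm_charFunIntegrand_le μ g x ξ)

variable [IsProbabilityMeasure μ]

theorem integrable_charFunIntegrand (hμ : Integrable (charFun μ)) {g : E → ℂ} (hg : Integrable g)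
    (x : E) : Integrable fun ξ => 𝓕 g ξ *
      (Complex.exp ((2 * Real.pi * inner ℝ ξ x : ℝ) * Complex.I) *
        charFun μ ((2 * Real.pi) • ξ)) := by
  refine ((integrable_norm_charFun_smul hμ).const_mul (∫ v, ‖g v‖)).mono' ?_
    (ae_of_all _ fun ξ => norm_charFunIntegrand_le μ g x ξ)
  refine (continuous_fourier hg).aestronglyMeasurable.mul
    (AEStronglyMeasurable.mul (Continuous.aestronglyMeasurable (by fun_prop)) ?_)
  exact (measurable_charFun.comp (measurable_const_smul _)).aestronglyMeasurable

/-- A probability measure with integrable characteristic function has bounded density. -/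
theorem exists_measure_le_smul_volume (hμ : Integrable (charFun μ)) :
    ∃ c : ℝ≥0∞, c ≠ ⊤ ∧ μ ≤ c • volume := by
  set K := ∫ ξ, ‖charFun μ ((2 * Real.pi) • ξ)‖
  have hK : 0 ≤ K := integral_nonneg fun _ => norm_nonneg _
  -- A smooth bump equal to 1 on `k` and supported in `U` is tested against `μ`. The Fourier formula
  -- bounds its `μ`-integral by its `L¹` norm times the `L¹` norm of the rescaled characteristic
  -- function.
  have hbump : ∀ U : Set E, IsOpen U → Bornology.IsBounded U → ∀ k ⊆ U, IsClosed k →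
      μ k ≤ ENNReal.ofReal K * volume U := fun U hU hUb k hkU hk => by
    obtain ⟨f, hfd, hfr, hfs, hf1⟩ :=
      exists_contMDiff_support_eq_eq_one_iff (n := (⊤ : ℕ∞)) 𝓘(ℝ, E) hU hk hkU
    have hf01 : ∀ x, 0 ≤ f x ∧ f x ≤ 1 := fun x => hfr ⟨x, rfl⟩
    have hfc : HasCompactSupport f := by
      rw [HasCompactSupport, tsupport, hfs]
      exact hUb.isCompact_closure
    have hfd' : ContDiff ℝ ∞ f := hfd.contDiff
    have hcompC : HasCompactSupport (fun x => (f x : ℂ)) := hfc.comp_left (g := Complex.ofReal) rfl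
    have hsmC : ContDiff ℝ ∞ (fun x => (f x : ℂ)) := Complex.ofRealCLM.contDiff.comp hfd'
    let g : 𝓢(E, ℂ) := hcompC.toSchwartzMap hsmC
    have hgf : ∀ x, g x = f x := fun x => rfl
    have h1 := integral_schwartz_comp_add μ g 0
    have h2 := norm_charFunIntegral_le hμ (g : E → ℂ) 0
    rw [charFunIntegral, ← h1] at h2
    simp only [zero_add, hgf, integral_complex_ofReal, Complex.norm_real, Real.norm_eq_abs] at h2
    have hfint : Integrable f := hfd'.continuous.integrable_of_hasCompactSupport hfc
    have hfintμ : Integrable f μ := hfd'.continuous.integrable_of_hasCompactSupport hfc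
    have h3 : μ.real k ≤ ∫ x, f x ∂μ := by
      rw [← integral_indicator_one hk.measurableSet]
      refine integral_mono ((integrable_const 1).indicator hk.measurableSet) hfintμ fun x => ?_
      by_cases hx : x ∈ k
      · simp [hx, (hf1 x).1 hx]
      · simp [hx, (hf01 x).1]
    have hUfin : volume U < ⊤ := hUb.measure_lt_top
    have h4 : ∫ x, |f x| ≤ volume.real U := by
      rw [← integral_indicator_one hU.measurableSet]
      refine integral_mono hfint.abs ((integrable_indicator_iff hU.measurableSet).2
        (integrableOn_const hUfin.ne)) fun x => ?_
      by_cases hx : x ∈ U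
      · simpa [hx, abs_of_nonneg (hf01 x).1] using (hf01 x).2
      · have : f x = 0 := by rwa [← Function.notMem_support, hfs]
        simp [hx, this]
    have h5 : μ.real k ≤ K * volume.real U := by
      calc _ ≤ |∫ x, f x ∂μ| := h3.trans (le_abs_self _)
        _ ≤ (∫ x, |f x|) * K := h2
        _ ≤ volume.real U * K := by gcongr
        _ = _ := mul_comm _ _
    rw [← ENNReal.ofReal_toReal (measure_ne_top μ k), ← ENNReal.ofReal_toReal hUfin.ne,
      ← ENNReal.ofReal_mul hK]
    exact ENNReal.ofReal_le_ofReal h5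
  have hopen : ∀ U : Set E, IsOpen U → μ U ≤ ENNReal.ofReal K * volume U := fun U hU => by
    rw [hU.measure_eq_iSup_isCompact]
    refine iSup₂_le fun k hkU => iSup_le fun hk => ?_
    obtain ⟨r, hr⟩ := hk.isBounded.subset_ball 0
    refine (hbump (U ∩ Metric.ball 0 r) (hU.inter Metric.isOpen_ball)
      (Metric.isBounded_ball.subset Set.inter_subset_right) k (Set.subset_inter hkU hr)
      hk.isClosed).trans ?_
    gcongr
    exact Set.inter_subset_left
  -- The added 1 keeps the constant nonzero, so it can be divided out before outer regularity of the
  -- volume is used.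
  refine ⟨ENNReal.ofReal K + 1, by simp, Measure.le_iff.2 fun s _ => ?_⟩
  rw [Measure.smul_apply, smul_eq_mul, mul_comm]
  rw [← ENNReal.div_le_iff_le_mul (Or.inl (by simp)) (Or.inl (by simp))]
  refine le_of_forall_gt fun r hr => ?_
  obtain ⟨U, hsU, hU, hUr⟩ := Set.exists_isOpen_lt_of_lt s r hr
  refine lt_of_le_of_lt ?_ hUr
  rw [ENNReal.div_le_iff_le_mul (Or.inl (by simp)) (Or.inl (by simp)), mul_comm]
  refine (measure_mono hsU).trans ((hopen U hU).trans ?_)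
  gcongr
  exact le_self_add

/-- The mean of a translate of an integrable function in terms of its Fourier transform and of the
characteristic function. -/
theorem integral_comp_add_eq_charFunIntegral (hμ : Integrable (charFun μ)) {Φ : E → ℂ}
    (hΦ : Integrable Φ) (x : E) : ∫ v, Φ (x + v) ∂μ = charFunIntegral μ Φ x := by
  -- The transform of an `L¹` function need not be integrable, so inversion is unavailable for `Φ`.
  -- Both sides are `L¹`-continuous in `Φ`, the left because `μ ≤ c • volume`, the right because the
  -- characteristic function is integrable; density of smooth compactly supported functions
  -- concludes.
  obtain ⟨c, hc, hμc⟩ := exists_measure_le_smul_volume hμ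
  set K := ∫ ξ, ‖charFun μ ((2 * Real.pi) • ξ)‖
  have hK : 0 ≤ K := integral_nonneg fun _ => norm_nonneg _
  have htrans : ∀ f : E → ℂ, Integrable f → Integrable (fun v => f (x + v)) μ := fun f hf =>
    ((hf.comp_add_left x).smul_measure hc).mono_measure hμc
  have hbound : ∀ f : E → ℂ, Integrable f →
      ‖∫ v, f (x + v) ∂μ‖ ≤ c.toReal * ∫ v, ‖f v‖ := fun f hf => by
    calc _ ≤ ∫ v, ‖f (x + v)‖ ∂μ := norm_integral_le_integral_norm _
      _ ≤ ∫ v, ‖f (x + v)‖ ∂(c • volume) :=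
        integral_mono_measure hμc (ae_of_all _ fun _ => norm_nonneg _)
          ((hf.comp_add_left x).norm.smul_measure hc)
      _ = _ := by
        rw [integral_smul_measure, smul_eq_mul, integral_add_left_eq_self (fun v => ‖f v‖)]
  rw [← sub_eq_zero, ← norm_le_zero_iff]
  refine le_of_forall_pos_le_add fun ε hε => ?_
  rw [zero_add]
  set δ := ε / (c.toReal + K + 1)
  have hden : 0 < c.toReal + K + 1 := by positivity
  have hδ : 0 < δ := by positivity
  obtain ⟨g, hgc, hgs, hg⟩ := MemLp.exist_eLpNorm_sub_le ENNReal.one_ne_top le_rfl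
    (memLp_one_iff_integrable.2 hΦ) hδ
  let s : 𝓢(E, ℂ) := hgc.toSchwartzMap hgs
  have hgi : Integrable g := s.integrable
  have hd : Integrable (Φ - g) := hΦ.sub hgi
  have hdn : ∫ v, ‖(Φ - g) v‖ ≤ δ := by
    rw [eLpNorm_one_eq_lintegral_enorm] at hg
    rw [integral_norm_eq_lintegral_enorm hd.1]
    exact ENNReal.toReal_le_of_le_ofReal hδ.le hg
  have h1 : ∫ v, Φ (x + v) ∂μ = ∫ v, (Φ - g) (x + v) ∂μ + charFunIntegral μ g x := by
    have : charFunIntegral μ g x = ∫ v, g (x + v) ∂μ := (integral_schwartz_comp_add μ s x).symm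
    rw [this, ← integral_add (htrans _ hd) (htrans _ hgi)]
    simp
  have h2 : charFunIntegral μ Φ x = charFunIntegral μ (Φ - g) x + charFunIntegral μ g x := by
    unfold charFunIntegral
    rw [← integral_add (integrable_charFunIntegrand hμ hd x)
      (integrable_charFunIntegrand hμ hgi x)]
    refine integral_congr_ae (ae_of_all _ fun ξ => ?_)
    have hF : 𝓕 Φ ξ = 𝓕 (Φ - g) ξ + 𝓕 g ξ := by
      have := VectorFourier.fourierIntegral_add (μ := (volume : Measure E)) (L := innerₗ E)
        Real.continuous_fourierChar (by simpa using continuous_inner) hd hgi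
      rw [sub_add_cancel] at this
      exact congrFun this ξ
    simp only [hF, add_mul]
  rw [h1, h2, add_sub_add_right_eq_sub]
  calc _ ≤ c.toReal * (∫ v, ‖(Φ - g) v‖) + (∫ v, ‖(Φ - g) v‖) * K :=
        (norm_sub_le _ _).trans (add_le_add (hbound _ hd) (norm_charFunIntegral_le hμ _ _))
    _ ≤ c.toReal * δ + δ * K := by gcongr
    _ ≤ δ * (c.toReal + K + 1) := by nlinarith
    _ = ε := by simp only [δ]; field_simp

end CharFunRepresentation

/-- Functions `x ↦ E[Φ (x + V)]`, with `Φ` integrable and `V` of Gaussian-type characteristic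
function, are superpositions of plane waves with Gaussian-type amplitudes. -/
theorem exists_planeWave_representation {d : ℕ} (μ : Measure (EuclideanSpace ℝ (Fin d)))
    [IsProbabilityMeasure μ] {C : ℝ} (hC : 0 < C)
    (hμ : ∀ ξ, ‖charFun μ ξ‖ ≤ Real.exp (-C * ‖ξ‖ ^ 2)) {Φ : EuclideanSpace ℝ (Fin d) → ℝ}
    (hΦ : Integrable Φ) :
    (∀ x, AEStronglyMeasurable (fun v => Φ (x + v)) μ) ∧
    ∃ h : EuclideanSpace ℝ (Fin d) → ℂ, Measurable h ∧
      (∀ ξ, ‖h ξ‖ ≤ ((2 * Real.pi) ^ d)⁻¹ * (∫ x, ‖Φ x‖) * Real.exp (-C * ‖ξ‖ ^ 2)) ∧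
      ∀ x, ∫ v, Φ (x + v) ∂μ =
        ∫ ξ, (h ξ * Complex.exp ((inner ℝ ξ x : ℝ) * Complex.I)).re := by
  have hint : Integrable (charFun μ) :=
    (integrable_rexp_neg_mul_sq_norm hC).mono' measurable_charFun.aestronglyMeasurable
      (ae_of_all _ hμ)
  have hΦC : Integrable (fun x => (Φ x : ℂ)) := hΦ.ofReal
  have hnorm : ∫ x, ‖(Φ x : ℂ)‖ = ∫ x, ‖Φ x‖ := by simp
  have hpi : 0 < 2 * Real.pi := by positivity
  -- The substitution `ξ ↦ 2πξ` passes from the convention `exp(2πi⟨ξ, x⟩)` to `exp(i⟨ξ, x⟩)`; its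
  -- Jacobian is the factor `(2π)^(-d)`.
  refine ⟨fun x => ?_, fun ξ => (((2 * Real.pi) ^ d)⁻¹ : ℝ) *
    (𝓕 (fun x => (Φ x : ℂ)) ((2 * Real.pi)⁻¹ • ξ) * charFun μ ξ), ?_, fun ξ => ?_, fun x => ?_⟩
  · obtain ⟨c, hc, hμc⟩ := exists_measure_le_smul_volume hint
    exact (((hΦ.comp_add_left x).smul_measure hc).mono_measure hμc).1
  · exact measurable_const.mul (((continuous_fourier hΦC).measurable.comp
      (measurable_const_smul _)).mul measurable_charFun)
  · rw [norm_mul, norm_mul, Complex.norm_real, Real.norm_of_nonneg (by positivity), mul_assoc]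
    gcongr
    · exact (norm_fourier_le _ _).trans_eq hnorm
    · exact hμ ξ
  · have h1 := integral_comp_add_eq_charFunIntegral hint hΦC x
    rw [integral_complex_ofReal] at h1
    have h2 : charFunIntegral μ (fun x => (Φ x : ℂ)) x = ∫ ξ, ((((2 * Real.pi) ^ d)⁻¹ : ℝ) *
        (𝓕 (fun x => (Φ x : ℂ)) ((2 * Real.pi)⁻¹ • ξ) * charFun μ ξ)) *
        Complex.exp ((inner ℝ ξ x : ℝ) * Complex.I) := by
      have h3 := Measure.integral_comp_smul (volume : Measure (EuclideanSpace ℝ (Fin d)))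
        (fun ξ => 𝓕 (fun x => (Φ x : ℂ)) ((2 * Real.pi)⁻¹ • ξ) * charFun μ ξ *
        Complex.exp ((inner ℝ ξ x : ℝ) * Complex.I)) (2 * Real.pi)
      simp only [finrank_euclideanSpace, Fintype.card_fin] at h3
      rw [abs_of_nonneg (by positivity)] at h3
      calc _ = ∫ ξ : EuclideanSpace ℝ (Fin d),
            𝓕 (fun x => (Φ x : ℂ)) ((2 * Real.pi)⁻¹ • (2 * Real.pi) • ξ) *
            charFun μ ((2 * Real.pi) • ξ) *
            Complex.exp ((inner ℝ ((2 * Real.pi) • ξ) x : ℝ) * Complex.I) := by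
            refine integral_congr_ae (ae_of_all _ fun ξ => ?_)
            simp only [smul_smul, inv_mul_cancel₀ hpi.ne', one_smul, real_inner_smul_left]
            ring
        _ = _ := by
            rw [h3, ← integral_smul]
            refine integral_congr_ae (ae_of_all _ fun ξ => ?_)
            simp only [Complex.real_smul]
            ring
    have h4 : Integrable fun ξ => ((((2 * Real.pi) ^ d)⁻¹ : ℝ) *
        (𝓕 (fun x => (Φ x : ℂ)) ((2 * Real.pi)⁻¹ • ξ) * charFun μ ξ)) *
        Complex.exp ((inner ℝ ξ x : ℝ) * Complex.I) := by
      refine ((hint.norm.const_mul (((2 * Real.pi) ^ d)⁻¹ * (∫ x, ‖Φ x‖)))).mono' ?_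
        (ae_of_all _ fun ξ => ?_)
      · refine (Measurable.mul ?_ (Continuous.measurable (by fun_prop))).aestronglyMeasurable
        exact measurable_const.mul (((continuous_fourier hΦC).measurable.comp
          (measurable_const_smul _)).mul measurable_charFun)
      · rw [norm_mul, Complex.norm_exp_ofReal_mul_I, mul_one, norm_mul, norm_mul,
          Complex.norm_real, Real.norm_of_nonneg (by positivity), mul_assoc]
        gcongr
        exact (norm_fourier_le _ _).trans_eq hnorm
    have h5 := congrArg Complex.re (h1.trans h2)
    rw [Complex.ofReal_re] at h5
    rw [h5]
    exact (integral_re h4).symm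

end RandomFeature

/-! ### Waves as superpositions of ReLU ridges -/

namespace RandomFeature

open scoped ENNReal

section Wave

/-- Density of the signed measure representing `u ↦ a cos u - c sin u` on `[-R, R]` as a
superposition of the ridge functions `u ↦ relu (u + b)`. -/
noncomputable def waveCoeff (a c R b : ℝ) : ℝ :=
  (Set.Ioc (-R) R).indicator (fun b => -(a * Real.cos b + c * Real.sin b)) b +
  (Set.Ioc R (R + 1)).indicator (fun b =>
    (4 * (a * Real.sin R - c * Real.cos R) - 6 * (a * Real.cos R + c * Real.sin R)) +
    (12 * (a * Real.cos R + c * Real.sin R) - 6 * (a * Real.sin R - c * Real.cos R)) * (b - R)) b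

theorem abs_cos_add_sin_le (a c b : ℝ) :
    |a * Real.cos b + c * Real.sin b| ≤ √(a ^ 2 + c ^ 2) := by
  refine Real.abs_le_sqrt ?_
  nlinarith [sq_nonneg (a * Real.sin b - c * Real.cos b), Real.sin_sq_add_cos_sq b]

theorem abs_sin_sub_cos_le (a c b : ℝ) :
    |a * Real.sin b - c * Real.cos b| ≤ √(a ^ 2 + c ^ 2) := by
  refine Real.abs_le_sqrt ?_
  nlinarith [sq_nonneg (a * Real.cos b + c * Real.sin b), Real.sin_sq_add_cos_sq b]

/-- The quantities multiplied by 4, 6, 12 and 6 are each at most `√(a² + c²)`, and `28 = (4 + 6) +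
(12 + 6)`. -/
theorem abs_waveCoeff_le {a c R b : ℝ} (hR : 0 ≤ R) :
    |waveCoeff a c R b| ≤ (Set.Icc (-(R + 1)) (R + 1)).indicator
      (fun _ => 28 * √(a ^ 2 + c ^ 2)) b := by
  have hr := Real.sqrt_nonneg (a ^ 2 + c ^ 2)
  unfold waveCoeff
  by_cases h1 : b ∈ Set.Ioc (-R) R
  · have h2 : b ∉ Set.Ioc R (R + 1) := fun h => not_lt.2 h1.2 h.1
    rw [Set.indicator_of_mem h1, Set.indicator_of_notMem h2,
      Set.indicator_of_mem (s := Set.Icc _ _) ⟨by linarith [h1.1], by linarith [h1.2]⟩,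
      add_zero, abs_neg]
    linarith [abs_cos_add_sin_le a c b]
  · by_cases h2 : b ∈ Set.Ioc R (R + 1)
    · rw [Set.indicator_of_notMem h1, Set.indicator_of_mem h2,
        Set.indicator_of_mem (s := Set.Icc _ _) ⟨by linarith [h2.1], h2.2⟩, zero_add]
      have e0 := abs_le.1 (abs_cos_add_sin_le a c R)
      have e1 := abs_le.1 (abs_sin_sub_cos_le a c R)
      set r := √(a ^ 2 + c ^ 2)
      set c0 := a * Real.cos R + c * Real.sin R
      set c1 := a * Real.sin R - c * Real.cos R
      have ht0 : 0 ≤ b - R := by linarith [h2.1]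
      have ht1 : b - R ≤ 1 := by linarith [h2.2]
      have hq : |12 * c0 - 6 * c1| ≤ 18 * r := abs_le.2 ⟨by linarith, by linarith⟩
      have hp : |4 * c1 - 6 * c0| ≤ 10 * r := abs_le.2 ⟨by linarith, by linarith⟩
      calc _ ≤ |4 * c1 - 6 * c0| + |(12 * c0 - 6 * c1) * (b - R)| := abs_add_le _ _
        _ = |4 * c1 - 6 * c0| + |12 * c0 - 6 * c1| * (b - R) := by
          rw [abs_mul, abs_of_nonneg ht0]
        _ ≤ 10 * r + 18 * r * 1 := by gcongr
        _ = _ := by ring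
    · rw [Set.indicator_of_notMem h1, Set.indicator_of_notMem h2, add_zero, abs_zero]
      exact Set.indicator_nonneg (fun _ _ => by positivity) _

theorem continuous_relu : Continuous relu := continuous_id.max continuous_const

/-- Taylor's formula at `-R` for `g(u) = a cos u - c sin u`: the integral remainder is `∫ g''(-b)
relu (u + b)` over `(-R, R]`. The affine part `c0 + c1 (u + R)` comes from biases in `(R, R+1]`,
where every ReLU is active; the linear density there solves `∫ p(t) dt = c1` and `∫ t p(t) dt = c0`
on `[0, 1]`. -/
theorem integral_waveCoeff_mul_relu {a c R u : ℝ} (hu : |u| ≤ R) :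
    ∫ b, waveCoeff a c R b * relu (u + b) = a * Real.cos u - c * Real.sin u := by
  have hu' := abs_le.1 hu
  have hR : 0 ≤ R := (abs_nonneg u).trans hu
  set c0 := a * Real.cos R + c * Real.sin R
  set c1 := a * Real.sin R - c * Real.cos R
  set f₁ : ℝ → ℝ := fun b => -(a * Real.cos b + c * Real.sin b) * relu (u + b)
  set f₂ : ℝ → ℝ := fun b => ((4 * c1 - 6 * c0) + (12 * c0 - 6 * c1) * (b - R)) * relu (u + b)
  have hrc : Continuous fun b => relu (u + b) := continuous_relu.comp (by fun_prop)
  have hf₁ : Continuous f₁ := by fun_prop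
  have hf₂ : Continuous f₂ := by fun_prop
  have heq : (fun b => waveCoeff a c R b * relu (u + b)) =
      fun b => (Set.Ioc (-R) R).indicator f₁ b + (Set.Ioc R (R + 1)).indicator f₂ b := by
    funext b
    simp only [waveCoeff, add_mul, f₁, f₂, Set.indicator]
    split_ifs <;> simp <;> ring
  have i₁ : Integrable ((Set.Ioc (-R) R).indicator f₁) :=
    (integrable_indicator_iff measurableSet_Ioc).2
      (hf₁.integrableOn_Icc.mono_set Set.Ioc_subset_Icc_self)
  have i₂ : Integrable ((Set.Ioc R (R + 1)).indicator f₂) :=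
    (integrable_indicator_iff measurableSet_Ioc).2
      (hf₂.integrableOn_Icc.mono_set Set.Ioc_subset_Icc_self)
  rw [heq, integral_add i₁ i₂, integral_indicator measurableSet_Ioc,
    integral_indicator measurableSet_Ioc, ← intervalIntegral.integral_of_le (by linarith),
    ← intervalIntegral.integral_of_le (by linarith),
    ← intervalIntegral.integral_add_adjacent_intervals (b := -u) (hf₁.intervalIntegrable _ _)
      (hf₁.intervalIntegrable _ _)]
  have h1 : ∫ b in (-R)..(-u), f₁ b = 0 := by
    rw [intervalIntegral.integral_congr (g := fun _ => 0)]
    · simp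
    · intro b hb
      rw [Set.uIcc_of_le (by linarith)] at hb
      simp only [f₁, relu]
      rw [max_eq_right (by linarith [hb.2]), mul_zero]
  have h2 : ∫ b in (-u)..R, f₁ b = a * Real.cos u - c * Real.sin u - (u + R) * c1 - c0 := by
    rw [intervalIntegral.integral_congr
      (g := fun b => -(a * Real.cos b + c * Real.sin b) * (u + b))]
    · rw [intervalIntegral.integral_eq_sub_of_hasDerivAt
        (f := fun b => -((u + b) * (a * Real.sin b - c * Real.cos b) +
          (a * Real.cos b + c * Real.sin b)))]
      · simp only [Real.cos_neg, Real.sin_neg]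
        ring
      · intro b _
        have hs := Real.hasDerivAt_sin b
        have hc := Real.hasDerivAt_cos b
        convert! ((((hasDerivAt_id b).const_add u).mul
          ((hs.const_mul a).sub (hc.const_mul c))).add
          ((hc.const_mul a).add (hs.const_mul c))).neg using 1
        simp
        ring
      · exact Continuous.intervalIntegrable (by fun_prop) _ _
    · intro b hb
      rw [Set.uIcc_of_le (by linarith)] at hb
      simp only [f₁, relu]
      rw [max_eq_left (by linarith [hb.1])]
  have h3 : ∫ b in R..(R + 1), f₂ b = (u + R) * c1 + c0 := by
    rw [intervalIntegral.integral_congr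
      (g := fun b => ((4 * c1 - 6 * c0) + (12 * c0 - 6 * c1) * (b - R)) * (u + b))]
    · rw [intervalIntegral.integral_eq_sub_of_hasDerivAt
        (f := fun b => (4 * c1 - 6 * c0) * (u + R) * (b - R) +
          ((4 * c1 - 6 * c0) + (12 * c0 - 6 * c1) * (u + R)) / 2 * (b - R) ^ 2 +
          (12 * c0 - 6 * c1) / 3 * (b - R) ^ 3)]
      · ring
      · intro b _
        have hb := (hasDerivAt_id b).sub_const R
        convert! ((hb.const_mul ((4 * c1 - 6 * c0) * (u + R))).add
          ((hb.pow 2).const_mul (((4 * c1 - 6 * c0) + (12 * c0 - 6 * c1) * (u + R)) / 2))).add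
          ((hb.pow 3).const_mul ((12 * c0 - 6 * c1) / 3)) using 1
        simp
        ring
      · exact Continuous.intervalIntegrable (by fun_prop) _ _
    · intro b hb
      rw [Set.uIcc_of_le (by linarith)] at hb
      simp only [f₂, relu]
      rw [max_eq_left (by linarith [hb.1])]
  rw [h1, h2, h3]
  ring

end Wave

/-! ### Growth estimates -/

section Growth

/-- With `y = εx`, restricting the integral for `Γ(p + 1) = p Γ(p)` to `t > y` leaves at least `y^p
exp(-y)`. The point is the factor `Γ(p)`, which cancels the normalization of the `t`-density. -/
theorem mul_rpow_le_exp_mul_Gamma {p ε x : ℝ} (hp : 0 < p) (hε : 0 < ε) (hx : 0 ≤ x) :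
    (ε * x) ^ p ≤ Real.exp (ε * x) * (p * Real.Gamma p) := by
  have hy : 0 ≤ ε * x := by positivity
  set y := ε * x
  rw [← Real.Gamma_add_one hp.ne', Real.Gamma_eq_integral (by positivity), add_sub_cancel_right]
  have hint : IntegrableOn (fun t : ℝ => Real.exp (-t) * t ^ p) (Set.Ioi 0) := by
    simpa using Real.GammaIntegral_convergent (s := p + 1) (by positivity)
  have h1 : y ^ p * Real.exp (-y) ≤ ∫ t in Set.Ioi 0, Real.exp (-t) * t ^ p := by
    calc y ^ p * Real.exp (-y) = ∫ t in Set.Ioi y, Real.exp (-t) * y ^ p := by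
          rw [integral_mul_const, integral_exp_neg_Ioi, mul_comm]
      _ ≤ ∫ t in Set.Ioi y, Real.exp (-t) * t ^ p := by
          refine setIntegral_mono_on ((integrableOn_exp_neg_Ioi y).mul_const _)
            (hint.mono_set (Set.Ioi_subset_Ioi hy)) measurableSet_Ioi fun t ht => ?_
          have : y ≤ t := le_of_lt ht
          gcongr
      _ ≤ _ := setIntegral_mono_set hint
          ((ae_restrict_iff' measurableSet_Ioi).2 (ae_of_all _ fun t ht => by
            have : (0 : ℝ) < t := ht
            positivity)) (Filter.Eventually.of_forall (Set.Ioi_subset_Ioi hy))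
  calc y ^ p = Real.exp y * (y ^ p * Real.exp (-y)) := by
        rw [mul_comm (y ^ p), ← mul_assoc, ← Real.exp_add]; simp
    _ ≤ _ := by gcongr

theorem pow_le_mul_exp (n : ℕ) {η : ℝ} (hη : 0 < η) {x : ℝ} (hx : 0 ≤ x) :
    x ^ n ≤ n.factorial / η ^ n * Real.exp (η * x) := by
  have h := Real.pow_div_factorial_le_exp (x := η * x) (by positivity) n
  rw [div_le_iff₀ (by positivity), mul_pow] at h
  rw [div_mul_eq_mul_div, le_div_iff₀ (by positivity)]
  linarith

theorem exists_abs_eval_le_mul_exp (p : Polynomial ℝ) {η : ℝ} (hη : 0 < η) :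
    ∃ K : ℝ, 0 ≤ K ∧ ∀ b, |p.eval b| ≤ K * Real.exp (η * |b|) := by
  induction p using Polynomial.induction_on' with
  | add p q hp hq =>
    obtain ⟨K, hK, h⟩ := hp
    obtain ⟨K', hK', h'⟩ := hq
    refine ⟨K + K', by positivity, fun b => ?_⟩
    rw [Polynomial.eval_add, add_mul]
    exact (abs_add_le _ _).trans (add_le_add (h b) (h' b))
  | monomial n a =>
    refine ⟨|a| * (n.factorial / η ^ n), by positivity, fun b => ?_⟩
    rw [Polynomial.eval_monomial, abs_mul, abs_pow, mul_assoc]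
    gcongr
    exact pow_le_mul_exp n hη (abs_nonneg b)

end Growth

end RandomFeature

/-! ### Importance weights and their second moment -/

namespace RandomFeature

open scoped ENNReal

variable {d : ℕ}

theorem studentTDensity_pos {ν : ℝ} (hν : 0 < ν) (x : EuclideanSpace ℝ (Fin d)) :
    0 < studentTDensity d ν x := by
  have h1 : 0 < Real.Gamma ((ν + d) / 2) := Real.Gamma_pos_of_pos (by positivity)
  have h2 : 0 < Real.Gamma (ν / 2) := Real.Gamma_pos_of_pos (by positivity)
  unfold studentTDensity
  positivity

theorem measurable_studentTDensity (d : ℕ) (ν : ℝ) : Measurable (studentTDensity d ν) := by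
  unfold studentTDensity
  fun_prop

/-- The polynomial factor `(1 + ‖x‖²/ν)^p`, `p = (ν + d)/2`, is traded for a Gaussian; `Γ(p)`
cancels and leaves only the factor `p`. The Gaussian rate `C` is half the decay rate of the squared
wave amplitude. -/
theorem inv_studentTDensity_le {ν C : ℝ} (hν : 0 < ν) (hC : 0 < C)
    (x : EuclideanSpace ℝ (Fin d)) :
    (studentTDensity d ν x)⁻¹ ≤
      Real.Gamma (ν / 2) * Real.exp (C * ν) / (C * ν) ^ (ν / 2) * (ν + d) *
        ((Real.pi / C) ^ ((d : ℝ) / 2) * Real.exp (C * ‖x‖ ^ 2)) := by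
  set p : ℝ := (ν + d) / 2 with hp
  have hp0 : 0 < p := by positivity
  have hG : 0 < Real.Gamma p := Real.Gamma_pos_of_pos hp0
  have hG2 : 0 < Real.Gamma (ν / 2) := Real.Gamma_pos_of_pos (by positivity)
  have hpi := Real.pi_pos
  have h0 := mul_rpow_le_exp_mul_Gamma (p := p) (ε := C) (x := ν + ‖x‖ ^ 2) hp0 hC (by positivity)
  have hbase : (1 + ν⁻¹ * ‖x‖ ^ 2) ^ p = (C * (ν + ‖x‖ ^ 2)) ^ p / (C * ν) ^ p := by
    rw [← Real.div_rpow (by positivity) (by positivity)]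
    congr 1
    field_simp
  have hCν : (C * ν) ^ p = (C * ν) ^ (ν / 2) * (C ^ ((d : ℝ) / 2) * ν ^ ((d : ℝ) / 2)) := by
    rw [← Real.mul_rpow hC.le hν.le, ← Real.rpow_add (by positivity), hp, add_div]
  have hinv : (studentTDensity d ν x)⁻¹ =
      Real.Gamma (ν / 2) * ν ^ ((d : ℝ) / 2) * Real.pi ^ ((d : ℝ) / 2) / Real.Gamma p *
        (1 + ν⁻¹ * ‖x‖ ^ 2) ^ p := by
    rw [studentTDensity, ← hp, neg_div, ← hp, Real.rpow_neg (by positivity), mul_inv, inv_inv,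
      inv_div]
  have h1 : (1 + ν⁻¹ * ‖x‖ ^ 2) ^ p / Real.Gamma p ≤
      Real.exp (C * (ν + ‖x‖ ^ 2)) * p / (C * ν) ^ p := by
    rw [hbase, div_div, div_le_div_iff₀ (by positivity) (by positivity)]
    calc _ ≤ Real.exp (C * (ν + ‖x‖ ^ 2)) * (p * Real.Gamma p) * (C * ν) ^ p := by gcongr
      _ = _ := by ring
  calc (studentTDensity d ν x)⁻¹ = Real.Gamma (ν / 2) * ν ^ ((d : ℝ) / 2) *
        Real.pi ^ ((d : ℝ) / 2) * ((1 + ν⁻¹ * ‖x‖ ^ 2) ^ p / Real.Gamma p) := by rw [hinv]; ring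
    _ ≤ Real.Gamma (ν / 2) * ν ^ ((d : ℝ) / 2) * Real.pi ^ ((d : ℝ) / 2) *
        (Real.exp (C * (ν + ‖x‖ ^ 2)) * p / (C * ν) ^ p) := by gcongr
    _ = Real.Gamma (ν / 2) * Real.exp (C * ν) / (C * ν) ^ (ν / 2) * p *
        ((Real.pi / C) ^ ((d : ℝ) / 2) * Real.exp (C * ‖x‖ ^ 2)) := by
        rw [hCν, Real.div_rpow hpi.le hC.le, mul_add, Real.exp_add]
        have : 0 < ν ^ ((d : ℝ) / 2) := by positivity
        field_simp
    _ ≤ _ := by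
        gcongr
        rw [hp]
        linarith [show (0 : ℝ) ≤ d by positivity]

/-- Amplitude density of the ridge functions `relu (⟨ξ, x⟩ + b)` in the plane wave superposition
with amplitude `h`, on the cube `[-M, M]^d`. -/
noncomputable def ridgeAmplitude (h : EuclideanSpace ℝ (Fin d) → ℂ) (M : ℝ)
    (p : EuclideanSpace ℝ (Fin d) × ℝ) : ℝ :=
  waveCoeff (h p.1).re (h p.1).im (M * √d * ‖p.1‖) p.2

theorem measurable_ridgeAmplitude {h : EuclideanSpace ℝ (Fin d) → ℂ} (hh : Measurable h) (M : ℝ) :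
    Measurable (ridgeAmplitude h M) := by
  classical
  have hre : Measurable fun p : EuclideanSpace ℝ (Fin d) × ℝ => (h p.1).re :=
    Complex.measurable_re.comp (hh.comp measurable_fst)
  have him : Measurable fun p : EuclideanSpace ℝ (Fin d) × ℝ => (h p.1).im :=
    Complex.measurable_im.comp (hh.comp measurable_fst)
  have hR : Measurable fun p : EuclideanSpace ℝ (Fin d) × ℝ => M * √d * ‖p.1‖ := by fun_prop
  unfold ridgeAmplitude waveCoeff
  simp only [Set.indicator_apply, Set.mem_Ioc]
  refine (Measurable.ite ?_ ?_ measurable_const).add (Measurable.ite ?_ ?_ measurable_const)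
  · exact (measurableSet_lt hR.neg measurable_snd).inter (measurableSet_le measurable_snd hR)
  · fun_prop
  · exact (measurableSet_lt hR measurable_snd).inter
      (measurableSet_le measurable_snd (hR.add_const 1))
  · fun_prop

theorem abs_inner_le_of_abs_le {M : ℝ} (hM : 0 ≤ M) {x : EuclideanSpace ℝ (Fin d)}
    (hx : ∀ j, |x j| ≤ M) (ξ : EuclideanSpace ℝ (Fin d)) : |inner ℝ ξ x| ≤ M * √d * ‖ξ‖ := by
  have h1 : ‖x‖ ≤ √d * M := by
    rw [EuclideanSpace.norm_eq, ← Real.sqrt_sq hM, ← Real.sqrt_mul (by positivity)]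
    refine Real.sqrt_le_sqrt ?_
    calc _ ≤ ∑ _j : Fin d, M ^ 2 := Finset.sum_le_sum fun j _ => by
          have := hx j
          rw [Real.norm_eq_abs]
          gcongr
      _ = _ := by simp
  calc _ ≤ ‖ξ‖ * ‖x‖ := abs_real_inner_le_norm _ _
    _ ≤ ‖ξ‖ * (√d * M) := by gcongr
    _ = _ := by ring

theorem integral_ridgeAmplitude_mul_relu {M : ℝ} (hM : 0 ≤ M)
    (h : EuclideanSpace ℝ (Fin d) → ℂ) {x : EuclideanSpace ℝ (Fin d)} (hx : ∀ j, |x j| ≤ M)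
    (ξ : EuclideanSpace ℝ (Fin d)) :
    ∫ b, ridgeAmplitude h M (ξ, b) * relu (inner ℝ ξ x + b) =
      (h ξ * Complex.exp ((inner ℝ ξ x : ℝ) * Complex.I)).re := by
  change ∫ b, waveCoeff (h ξ).re (h ξ).im (M * √d * ‖ξ‖) b * relu (inner ℝ ξ x + b) = _
  rw [integral_waveCoeff_mul_relu (abs_inner_le_of_abs_le hM hx ξ), Complex.mul_re,
    Complex.exp_ofReal_mul_I_re, Complex.exp_ofReal_mul_I_im]

theorem abs_relu_le (z : ℝ) : |relu z| ≤ |z| := by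
  rw [relu, abs_of_nonneg (le_max_right _ _)]
  exact max_le (le_abs_self z) (abs_nonneg z)

/-- Exponential slack in the dimension. -/
theorem dimension_factor_le_one {C : ℝ} (hC : 1 / (2 ^ (3 / 2 : ℝ) * Real.pi) < C) (d : ℕ) :
    (((2 * Real.pi) ^ d)⁻¹) ^ 2 * ((Real.pi / C) ^ ((d : ℝ) / 2) *
      ((Real.pi / (3 * C / 4)) ^ ((d : ℝ) / 2) * (3 / 2 : ℝ) ^ ((d : ℝ) / 2))) ≤ 1 := by
  have hpi := Real.pi_pos
  have hC0 : 0 < C := lt_trans (by positivity) hC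
  have hC2 : 1 < 8 * Real.pi ^ 2 * C ^ 2 := by
    rw [div_lt_iff₀ (by positivity)] at hC
    have h2 : ((2 : ℝ) ^ (3 / 2 : ℝ)) ^ 2 = 8 := by
      rw [← Real.rpow_natCast, ← Real.rpow_mul (by norm_num)]
      norm_num
    calc (1 : ℝ) = 1 ^ 2 := by norm_num
      _ < (C * (2 ^ (3 / 2 : ℝ) * Real.pi)) ^ 2 := by gcongr
      _ = _ := by rw [mul_pow, mul_pow, h2]; ring
  have e1 : (((2 * Real.pi) ^ d)⁻¹) ^ 2 = (((2 * Real.pi) ^ 4)⁻¹) ^ ((d : ℝ) / 2) := by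
    rw [Real.inv_rpow (by positivity), ← Real.rpow_natCast (2 * Real.pi) 4,
      ← Real.rpow_mul (by positivity), inv_pow, ← pow_mul, ← Real.rpow_natCast]
    congr 2
    push_cast
    ring
  rw [e1, ← Real.mul_rpow (by positivity) (by positivity),
    ← Real.mul_rpow (by positivity) (by positivity),
    ← Real.mul_rpow (by positivity) (by positivity)]
  refine Real.rpow_le_one (by positivity) ?_ (by positivity)
  -- The base of the power `d/2`. Without slack it would be `1/(16π²C²)`; the factor 2 between the
  -- two is used up as `4/3` from the Gaussian rate `3C/4` and `3/2` from the bias density.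
  have : ((2 * Real.pi) ^ 4)⁻¹ * (Real.pi / C * (Real.pi / (3 * C / 4) * (3 / 2))) =
      1 / (8 * Real.pi ^ 2 * C ^ 2) := by
    field_simp
    norm_num
  rw [this, div_le_one (by positivity)]
  exact hC2.le

/-- The importance weight turning a plane wave superposition into an expectation of random
features. -/
noncomputable def importanceWeight (h : EuclideanSpace ℝ (Fin d) → ℂ) (M ν : ℝ) (πb : ℝ → ℝ)
    (p : EuclideanSpace ℝ (Fin d) × ℝ) : ℝ :=
  ridgeAmplitude h M p / (studentTDensity d ν p.1 * πb p.2)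

theorem measurable_importanceWeight {h : EuclideanSpace ℝ (Fin d) → ℂ} (hh : Measurable h)
    (M ν : ℝ) {πb : ℝ → ℝ} (hπ : Measurable πb) : Measurable (importanceWeight h M ν πb) :=
  (measurable_ridgeAmplitude hh M).div
    (((measurable_studentTDensity d ν).comp measurable_fst).mul (hπ.comp measurable_snd))

theorem measurable_relu : Measurable relu := continuous_relu.measurable

theorem measurable_ridge (x : EuclideanSpace ℝ (Fin d)) :
    Measurable fun p : EuclideanSpace ℝ (Fin d) × ℝ => relu (inner ℝ p.1 x + p.2) :=
  (continuous_relu.comp (by fun_prop)).measurable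

theorem studentT_prod_withDensity (ν : ℝ) {πb : ℝ → ℝ} (hπ : Measurable πb) :
    (studentT d ν).prod (volume.withDensity fun z => ENNReal.ofReal (πb z)) =
      (volume : Measure (EuclideanSpace ℝ (Fin d) × ℝ)).withDensity fun p =>
        ENNReal.ofReal (studentTDensity d ν p.1) * ENNReal.ofReal (πb p.2) := by
  rw [studentT, prod_withDensity (measurable_studentTDensity d ν).ennreal_ofReal hπ.ennreal_ofReal]
  rfl

/-- Replacing the polynomial by an exponential of arbitrarily small rate lets the Gaussian absorb
it, which avoids a power of the dimension depending on the degree. -/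
theorem AtMostPolynomialDecay.exists_inv_le {πb : ℝ → ℝ} (hπ : AtMostPolynomialDecay πb) {η : ℝ}
    (hη : 0 < η) : (∀ z, 0 < πb z) ∧ ∃ K : ℝ, 0 ≤ K ∧ ∀ b, (πb b)⁻¹ ≤ K * Real.exp (η * |b|) := by
  obtain ⟨p, hp, h⟩ := hπ
  have hpos : ∀ z, 0 < πb z := fun z =>
    pos_of_mul_pos_right (lt_of_lt_of_le one_pos (h z)) (hp z).le
  obtain ⟨K, hK, hKp⟩ := exists_abs_eval_le_mul_exp p hη
  refine ⟨hpos, K, hK, fun b => ?_⟩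
  rw [inv_le_iff_one_le_mul₀ (hpos b)]
  refine (h b).trans ?_
  gcongr
  · exact (hpos b).le
  · exact (le_abs_self _).trans (hKp b)

/-- Second moment bound for the importance-weighted random features, uniform in the dimension up to
a linear factor. -/
theorem exists_lintegral_sq_importanceWeight_le {πb : ℝ → ℝ} (hπm : Measurable πb)
    (hπ : AtMostPolynomialDecay πb) {ν C M : ℝ} (hν : 0 < ν)
    (hC : 1 / (2 ^ (3 / 2 : ℝ) * Real.pi) < C) (hM : 0 < M) :
    ∃ K : ℝ, 0 ≤ K ∧ ∀ (d : ℕ) (h : EuclideanSpace ℝ (Fin d) → ℂ) (S : ℝ), Measurable h → 0 ≤ S →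
      (∀ ξ, ‖h ξ‖ ≤ ((2 * Real.pi) ^ d)⁻¹ * S * Real.exp (-C * ‖ξ‖ ^ 2)) →
      ∀ x : EuclideanSpace ℝ (Fin d), (∀ j, |x j| ≤ M) →
        ∫⁻ p, ENNReal.ofReal ((importanceWeight h M ν πb p * relu (inner ℝ p.1 x + p.2)) ^ 2)
          ∂((studentT d ν).prod (volume.withDensity fun z => ENNReal.ofReal (πb z))) ≤
        ENNReal.ofReal (K * (ν + d) * S ^ 2) := by
  have hpi := Real.pi_pos
  have hC0 : 0 < C := lt_trans (by positivity) hC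
  have hlog : 0 < Real.log (3 / 2) := Real.log_pos (by norm_num)
  -- Chosen so that completing the square in `2ηM√d‖ξ‖` against `C/4 * ‖ξ‖²` costs exactly
  -- `(3/2)^(d/2)`.
  set η : ℝ := √(C * Real.log (3 / 2) / 8) / M
  have hη : 0 < η := by positivity
  have hη2 : 4 * (η * M) ^ 2 / C = Real.log (3 / 2) / 2 := by
    simp only [η]
    rw [div_mul_cancel₀ _ hM.ne', Real.sq_sqrt (by positivity)]
    field_simp
    norm_num
  obtain ⟨hπpos, K₁, hK₁, hπinv⟩ := hπ.exists_inv_le hη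
  set K₂ := Real.Gamma (ν / 2) * Real.exp (C * ν) / (C * ν) ^ (ν / 2)
  have hG2 : 0 < Real.Gamma (ν / 2) := Real.Gamma_pos_of_pos (by positivity)
  have hK₂ : 0 ≤ K₂ := by positivity
  -- Here `784 = 28²`. The 8 comes from the squared ReLU bound times the length of the bias
  -- interval, `(2(R+1))³`; `6/η³ = 3!/η³` bounds the cube by an exponential; `exp(2η)` is the shift
  -- by 1 in the two exponentials.
  set K₃ := 784 * K₁ * (8 * (6 / η ^ 3)) * Real.exp (2 * η)
  have hK₃ : 0 ≤ K₃ := by positivity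
  refine ⟨K₃ * K₂, by positivity, fun d h S hh hS hhb x hx => ?_⟩
  set R : EuclideanSpace ℝ (Fin d) → ℝ := fun ξ => M * √d * ‖ξ‖
  have hR : ∀ ξ, 0 ≤ R ξ := fun ξ => by positivity
  set A : ℝ := (((2 * Real.pi) ^ d)⁻¹) ^ 2 * ((Real.pi / C) ^ ((d : ℝ) / 2) *
    (3 / 2 : ℝ) ^ ((d : ℝ) / 2))
  -- bound of the integrand
  have hpt : ∀ ξ b, ENNReal.ofReal (studentTDensity d ν ξ) * ENNReal.ofReal (πb b) *
      ENNReal.ofReal ((importanceWeight h M ν πb (ξ, b) * relu (inner ℝ ξ x + b)) ^ 2) ≤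
      (Set.Icc (-(R ξ + 1)) (R ξ + 1)).indicator (fun _ => ENNReal.ofReal
        (784 * ‖h ξ‖ ^ 2 * (studentTDensity d ν ξ)⁻¹ * (K₁ * Real.exp (η * (R ξ + 1))) *
          (2 * (R ξ + 1)) ^ 2)) b := fun ξ b => by
    have hs := studentTDensity_pos (d := d) hν ξ
    have hb := hπpos b
    have hR0 := hR ξ
    rw [← ENNReal.ofReal_mul hs.le, ← ENNReal.ofReal_mul (by positivity)]
    have hw := abs_waveCoeff_le (a := (h ξ).re) (c := (h ξ).im) (b := b) (hR ξ)
    have hnorm : √((h ξ).re ^ 2 + (h ξ).im ^ 2) = ‖h ξ‖ := by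
      rw [Complex.norm_def, Complex.normSq_apply, sq, sq]
    rw [hnorm] at hw
    have heq : studentTDensity d ν ξ * πb b *
        (importanceWeight h M ν πb (ξ, b) * relu (inner ℝ ξ x + b)) ^ 2 =
        |ridgeAmplitude h M (ξ, b)| ^ 2 * (studentTDensity d ν ξ)⁻¹ * (πb b)⁻¹ *
          |relu (inner ℝ ξ x + b)| ^ 2 := by
      simp only [importanceWeight, sq_abs]
      field_simp
    rw [heq]
    change |ridgeAmplitude h M (ξ, b)| ≤ _ at hw
    by_cases hbm : b ∈ Set.Icc (-(R ξ + 1)) (R ξ + 1)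
    · rw [Set.indicator_of_mem hbm] at hw ⊢
      refine ENNReal.ofReal_le_ofReal ?_
      have hbabs : |b| ≤ R ξ + 1 := abs_le.2 hbm
      have hrelu : |relu (inner ℝ ξ x + b)| ≤ 2 * (R ξ + 1) := by
        refine (abs_relu_le _).trans ((abs_add_le _ _).trans ?_)
        have := abs_inner_le_of_abs_le hM.le hx ξ
        change _ ≤ R ξ at this
        linarith
      have hinv : (πb b)⁻¹ ≤ K₁ * Real.exp (η * (R ξ + 1)) :=
        (hπinv b).trans (by gcongr)
      calc _ ≤ (28 * ‖h ξ‖) ^ 2 * (studentTDensity d ν ξ)⁻¹ * (K₁ * Real.exp (η * (R ξ + 1))) *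
            (2 * (R ξ + 1)) ^ 2 := by gcongr
        _ = _ := by ring
    · rw [Set.indicator_of_notMem hbm] at hw ⊢
      have : |ridgeAmplitude h M (ξ, b)| = 0 := le_antisymm hw (abs_nonneg _)
      simp [this]
  have hinner : ∀ ξ, 784 * ‖h ξ‖ ^ 2 * (studentTDensity d ν ξ)⁻¹ *
      (K₁ * Real.exp (η * (R ξ + 1))) * (2 * (R ξ + 1)) ^ 2 * (2 * (R ξ + 1)) ≤
      K₃ * K₂ * (ν + d) * S ^ 2 * A * Real.exp (-(3 * C / 4) * ‖ξ‖ ^ 2) := fun ξ => by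
    have hR0 := hR ξ
    have h3 := pow_le_mul_exp 3 hη (x := R ξ + 1) (by positivity)
    norm_num [Nat.factorial] at h3
    -- The amplitude squared times the inverse density leaves `exp(-C‖ξ‖²)`; a quarter of this rate
    -- is spent here, leaving `3C/4`.
    have hexpR : Real.exp (2 * η * R ξ) ≤
        Real.exp (C / 4 * ‖ξ‖ ^ 2) * (3 / 2 : ℝ) ^ ((d : ℝ) / 2) := by
      rw [Real.rpow_def_of_pos (by norm_num), ← Real.exp_add]
      refine Real.exp_le_exp.2 ?_
      have e : Real.log (3 / 2) * ((d : ℝ) / 2) = 4 * (η * M) ^ 2 / C * d := by rw [hη2]; ring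
      rw [e]
      have hsd : √(d : ℝ) ^ 2 = d := Real.sq_sqrt (by positivity)
      have : 0 ≤ C / 4 * (‖ξ‖ - 4 * (η * M) / C * √d) ^ 2 := by positivity
      have e2 : C / 4 * (‖ξ‖ - 4 * (η * M) / C * √d) ^ 2 =
          C / 4 * ‖ξ‖ ^ 2 + 4 * (η * M) ^ 2 / C * √d ^ 2 - 2 * η * (M * √d * ‖ξ‖) := by
        field_simp
        ring
      rw [e2, hsd] at this
      simp only [R]
      linarith
    have hinv := inv_studentTDensity_le (d := d) hν hC0 ξ
    have hs := studentTDensity_pos (d := d) hν ξ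
    calc _ = 784 * ‖h ξ‖ ^ 2 * (studentTDensity d ν ξ)⁻¹ *
          (K₁ * Real.exp (η * (R ξ + 1))) * (8 * (R ξ + 1) ^ 3) := by ring
      _ ≤ 784 * (((2 * Real.pi) ^ d)⁻¹ * S * Real.exp (-C * ‖ξ‖ ^ 2)) ^ 2 *
          (K₂ * (ν + d) * ((Real.pi / C) ^ ((d : ℝ) / 2) * Real.exp (C * ‖ξ‖ ^ 2))) *
          (K₁ * Real.exp (η * (R ξ + 1))) * (8 * (6 / η ^ 3 * Real.exp (η * (R ξ + 1)))) := by
          gcongr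
          exact hhb ξ
      _ = 784 * K₁ * (8 * (6 / η ^ 3)) * K₂ * (ν + d) * S ^ 2 *
          ((((2 * Real.pi) ^ d)⁻¹) ^ 2 * (Real.pi / C) ^ ((d : ℝ) / 2)) *
          (Real.exp (-C * ‖ξ‖ ^ 2) ^ 2 * Real.exp (C * ‖ξ‖ ^ 2)) *
          (Real.exp (η * (R ξ + 1)) * Real.exp (η * (R ξ + 1))) := by ring
      _ = 784 * K₁ * (8 * (6 / η ^ 3)) * K₂ * (ν + d) * S ^ 2 *
          ((((2 * Real.pi) ^ d)⁻¹) ^ 2 * (Real.pi / C) ^ ((d : ℝ) / 2)) *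
          Real.exp (-C * ‖ξ‖ ^ 2) *
          (Real.exp (2 * η) * Real.exp (2 * η * R ξ)) := by
          congr 1
          · congr 1
            rw [sq, ← Real.exp_add, ← Real.exp_add]
            congr 1
            ring
          · rw [← Real.exp_add, ← Real.exp_add]
            congr 1
            ring
      _ ≤ 784 * K₁ * (8 * (6 / η ^ 3)) * K₂ * (ν + d) * S ^ 2 *
          ((((2 * Real.pi) ^ d)⁻¹) ^ 2 * (Real.pi / C) ^ ((d : ℝ) / 2)) *
          Real.exp (-C * ‖ξ‖ ^ 2) *
          (Real.exp (2 * η) * (Real.exp (C / 4 * ‖ξ‖ ^ 2) * (3 / 2 : ℝ) ^ ((d : ℝ) / 2))) := by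
          gcongr
      _ = K₃ * K₂ * (ν + d) * S ^ 2 * A *
          (Real.exp (-C * ‖ξ‖ ^ 2) * Real.exp (C / 4 * ‖ξ‖ ^ 2)) := by
          simp only [K₃, A]
          ring
      _ = _ := by
          rw [← Real.exp_add]
          congr 2
          ring
  rw [studentT_prod_withDensity ν hπm]
  have hmd : Measurable fun p : EuclideanSpace ℝ (Fin d) × ℝ =>
      ENNReal.ofReal (studentTDensity d ν p.1) * ENNReal.ofReal (πb p.2) :=
    ((measurable_studentTDensity d ν).comp measurable_fst).ennreal_ofReal.mul
      (hπm.comp measurable_snd).ennreal_ofReal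
  have hmw : Measurable fun p : EuclideanSpace ℝ (Fin d) × ℝ =>
      ENNReal.ofReal ((importanceWeight h M ν πb p * relu (inner ℝ p.1 x + p.2)) ^ 2) :=
    (((measurable_importanceWeight hh M ν hπm).mul (measurable_ridge x)).pow_const 2).ennreal_ofReal
  rw [lintegral_withDensity_eq_lintegral_mul _ hmd hmw, Measure.volume_eq_prod,
    lintegral_prod _ (hmd.mul hmw).aemeasurable]
  have hb34 : 0 < 3 * C / 4 := by positivity
  calc _ ≤ ∫⁻ ξ : EuclideanSpace ℝ (Fin d), ENNReal.ofReal (K₃ * K₂ * (ν + d) * S ^ 2 * A *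
        Real.exp (-(3 * C / 4) * ‖ξ‖ ^ 2)) := by
        refine lintegral_mono fun ξ => ?_
        refine (lintegral_mono (hpt ξ)).trans ?_
        rw [lintegral_indicator measurableSet_Icc, setLIntegral_const, Real.volume_Icc,
          ← ENNReal.ofReal_mul]
        · refine ENNReal.ofReal_le_ofReal (le_trans (le_of_eq ?_) (hinner ξ))
          ring
        · have hs := studentTDensity_pos (d := d) hν ξ
          have hR0 := hR ξ
          positivity
    _ = ENNReal.ofReal (∫ ξ : EuclideanSpace ℝ (Fin d), K₃ * K₂ * (ν + d) * S ^ 2 * A *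
        Real.exp (-(3 * C / 4) * ‖ξ‖ ^ 2)) :=
        (ofReal_integral_eq_lintegral_ofReal ((integrable_rexp_neg_mul_sq_norm hb34).const_mul _)
          (ae_of_all _ fun ξ => by positivity)).symm
    _ ≤ _ := by
        refine ENNReal.ofReal_le_ofReal ?_
        rw [integral_const_mul, GaussianFourier.integral_rexp_neg_mul_sq_norm hb34,
          finrank_euclideanSpace, Fintype.card_fin]
        have hdim := dimension_factor_le_one hC d
        calc _ = K₃ * K₂ * (ν + d) * S ^ 2 * ((((2 * Real.pi) ^ d)⁻¹) ^ 2 *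
              ((Real.pi / C) ^ ((d : ℝ) / 2) * ((Real.pi / (3 * C / 4)) ^ ((d : ℝ) / 2) *
                (3 / 2 : ℝ) ^ ((d : ℝ) / 2)))) := by
              simp only [A]
              ring
          _ ≤ K₃ * K₂ * (ν + d) * S ^ 2 * 1 := by gcongr
          _ = _ := mul_one _

end RandomFeature

/-! ### Monte Carlo approximation by random features -/

namespace RandomFeature

open scoped ENNReal

/-- Monte Carlo rate for an empirical mean of square-integrable samples. -/
theorem lintegral_sq_mean_sub_le {α : Type*} [MeasurableSpace α] (μ : Measure α)
    [IsProbabilityMeasure μ] {f : α → ℝ} (hf : MemLp f 2 μ) {N : ℕ} (hN : N ≠ 0) :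
    ∫⁻ ω : Fin N → α, ENNReal.ofReal ((∫ a, f a ∂μ - ∑ i, (N : ℝ)⁻¹ * f (ω i)) ^ 2)
      ∂(Measure.pi fun _ => μ) ≤ ENNReal.ofReal ((∫ a, f a ^ 2 ∂μ) / N) := by
  have hN' : (0 : ℝ) < N := by positivity
  have hg : MemLp (fun a => (N : ℝ)⁻¹ * f a) 2 μ := hf.const_mul _
  have hgi : ∀ i : Fin N, MemLp (fun ω : Fin N → α => (N : ℝ)⁻¹ * f (ω i)) 2
      (Measure.pi fun _ => μ) := fun i =>
    hg.comp_measurePreserving (measurePreserving_eval (fun _ : Fin N => μ) i)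
  have hmean : ∫ ω : Fin N → α, ∑ i, (N : ℝ)⁻¹ * f (ω i) ∂(Measure.pi fun _ => μ) =
      ∫ a, f a ∂μ := by
    rw [integral_finsetSum _ fun i _ => (hgi i).integrable (by norm_num)]
    have h1 : ∀ i : Fin N, ∫ ω : Fin N → α, (N : ℝ)⁻¹ * f (ω i) ∂(Measure.pi fun _ => μ) =
        (N : ℝ)⁻¹ * ∫ a, f a ∂μ := fun i => by
      have hmp := measurePreserving_eval (fun _ : Fin N => μ) i
      have h2 := integral_map (μ := Measure.pi fun _ : Fin N => μ)
        (φ := Function.eval i) hmp.measurable.aemeasurable (f := fun a => (N : ℝ)⁻¹ * f a)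
        (by rw [hmp.map_eq]; exact hg.1)
      rw [hmp.map_eq, integral_const_mul] at h2
      exact h2.symm
    simp [h1, hN'.ne']
  have hvar := variance_sum_pi (μ := fun _ : Fin N => μ) (fun _ => hg)
  have hsum : MemLp (∑ i : Fin N, fun ω : Fin N → α => (N : ℝ)⁻¹ * f (ω i)) 2
      (Measure.pi fun _ => μ) := memLp_finsetSum' _ fun i _ => hgi i
  have hsumf : (∑ i : Fin N, fun ω : Fin N → α => (N : ℝ)⁻¹ * f (ω i)) =
      fun ω => ∑ i, (N : ℝ)⁻¹ * f (ω i) := by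
    funext ω
    simp
  rw [hsumf] at hvar hsum
  rw [variance_eq_integral hsum.1.aemeasurable, hmean] at hvar
  have hint : Integrable (fun ω : Fin N → α =>
      (∑ i, (N : ℝ)⁻¹ * f (ω i) - ∫ a, f a ∂μ) ^ 2) (Measure.pi fun _ => μ) :=
    (hsum.sub (memLp_const _)).integrable_sq
  simp_rw [sub_sq_comm (∫ a, f a ∂μ)]
  rw [← ofReal_integral_eq_lintegral_ofReal hint (ae_of_all _ fun _ => sq_nonneg _), hvar]
  refine ENNReal.ofReal_le_ofReal ?_
  rw [variance_const_mul]
  have hle : Var[f; μ] ≤ ∫ a, f a ^ 2 ∂μ := variance_le_expectation_sq hf.1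
  simp only [Finset.sum_const, Finset.card_univ, Fintype.card_fin, nsmul_eq_mul]
  calc (N : ℝ) * ((N : ℝ)⁻¹ ^ 2 * Var[f; μ]) = Var[f; μ] / N := by field_simp
    _ ≤ _ := by gcongr

variable {d : ℕ}

/-- The importance-weighted random features have mean equal to the plane wave superposition. -/
theorem integral_importanceWeight_mul_relu {ν M : ℝ} (hν : 0 < ν) (hM : 0 ≤ M) {πb : ℝ → ℝ}
    (hπm : Measurable πb) (hπpos : ∀ z, 0 < πb z) {h : EuclideanSpace ℝ (Fin d) → ℂ}
    {x : EuclideanSpace ℝ (Fin d)} (hx : ∀ j, |x j| ≤ M)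
    (hint : Integrable (fun p => importanceWeight h M ν πb p * relu (inner ℝ p.1 x + p.2))
      ((studentT d ν).prod (volume.withDensity fun z => ENNReal.ofReal (πb z)))) :
    ∫ p, importanceWeight h M ν πb p * relu (inner ℝ p.1 x + p.2)
      ∂((studentT d ν).prod (volume.withDensity fun z => ENNReal.ofReal (πb z))) =
      ∫ ξ, (h ξ * Complex.exp ((inner ℝ ξ x : ℝ) * Complex.I)).re := by
  have hmd : Measurable fun p : EuclideanSpace ℝ (Fin d) × ℝ =>
      ENNReal.ofReal (studentTDensity d ν p.1) * ENNReal.ofReal (πb p.2) :=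
    ((measurable_studentTDensity d ν).comp measurable_fst).ennreal_ofReal.mul
      (hπm.comp measurable_snd).ennreal_ofReal
  have hfin : ∀ᵐ p : EuclideanSpace ℝ (Fin d) × ℝ,
      ENNReal.ofReal (studentTDensity d ν p.1) * ENNReal.ofReal (πb p.2) < ⊤ :=
    ae_of_all _ fun p => ENNReal.mul_lt_top ENNReal.ofReal_lt_top ENNReal.ofReal_lt_top
  have heq : ∀ p : EuclideanSpace ℝ (Fin d) × ℝ,
      (ENNReal.ofReal (studentTDensity d ν p.1) * ENNReal.ofReal (πb p.2)).toReal •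
        (importanceWeight h M ν πb p * relu (inner ℝ p.1 x + p.2)) =
      ridgeAmplitude h M p * relu (inner ℝ p.1 x + p.2) := fun p => by
    have hs := studentTDensity_pos (d := d) hν p.1
    have hb := hπpos p.2
    rw [ENNReal.toReal_mul, ENNReal.toReal_ofReal hs.le, ENNReal.toReal_ofReal hb.le,
      importanceWeight, smul_eq_mul]
    field_simp
  rw [studentT_prod_withDensity ν hπm] at hint ⊢
  rw [integrable_withDensity_iff_integrable_smul' hmd hfin] at hint
  rw [integral_withDensity_eq_integral_toReal_smul hmd hfin]
  simp_rw [heq] at hint ⊢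
  rw [Measure.volume_eq_prod] at hint ⊢
  rw [integral_prod _ hint]
  exact integral_congr_ae (ae_of_all _ fun ξ => integral_ridgeAmplitude_mul_relu hM h hx ξ)

/-- Random weights for the hidden layer, as a function of the hidden weights. -/
noncomputable def importanceWeights (h : EuclideanSpace ℝ (Fin d) → ℂ) (M ν : ℝ) (πb : ℝ → ℝ)
    {N : ℕ} (θ : (Fin N → EuclideanSpace ℝ (Fin d)) × (Fin N → ℝ)) (i : Fin N) : ℝ :=
  (N : ℝ)⁻¹ * importanceWeight h M ν πb (θ.1 i, θ.2 i)

theorem measurable_importanceWeights {h : EuclideanSpace ℝ (Fin d) → ℂ} (hh : Measurable h)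
    (M ν : ℝ) {πb : ℝ → ℝ} (hπ : Measurable πb) {N : ℕ} :
    Measurable (importanceWeights (N := N) h M ν πb) :=
  measurable_pi_iff.2 fun i => measurable_const.mul
    ((measurable_importanceWeight hh M ν hπ).comp (by fun_prop))

/-- Random feature approximation of a plane wave superposition. -/
theorem lintegral_sq_sub_network_le {ν M : ℝ} (hν : 0 < ν) (hM : 0 ≤ M) {πb : ℝ → ℝ}
    (hπm : Measurable πb) (hπpos : ∀ z, 0 < πb z) [IsProbabilityMeasure (studentT d ν)]
    [IsProbabilityMeasure (volume.withDensity fun z => ENNReal.ofReal (πb z))]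
    {h : EuclideanSpace ℝ (Fin d) → ℂ} (hh : Measurable h) {N : ℕ} (hN : N ≠ 0)
    {x : EuclideanSpace ℝ (Fin d)} (hx : ∀ j, |x j| ≤ M) {Q : ℝ} (hQ : 0 ≤ Q)
    (hsq : ∫⁻ p, ENNReal.ofReal ((importanceWeight h M ν πb p * relu (inner ℝ p.1 x + p.2)) ^ 2)
      ∂((studentT d ν).prod (volume.withDensity fun z => ENNReal.ofReal (πb z))) ≤
        ENNReal.ofReal Q) :
    ∫⁻ θ : (Fin N → EuclideanSpace ℝ (Fin d)) × (Fin N → ℝ), ENNReal.ofReal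
      (((∫ ξ, (h ξ * Complex.exp ((inner ℝ ξ x : ℝ) * Complex.I)).re) -
        network θ.1 θ.2 (importanceWeights h M ν πb θ) x) ^ 2)
      ∂((Measure.pi fun _ => studentT d ν).prod
        (Measure.pi fun _ => volume.withDensity fun z => ENNReal.ofReal (πb z))) ≤
      ENNReal.ofReal (Q / N) := by
  set μ := (studentT d ν).prod (volume.withDensity fun z => ENNReal.ofReal (πb z))
  set f : EuclideanSpace ℝ (Fin d) × ℝ → ℝ := fun p =>
    importanceWeight h M ν πb p * relu (inner ℝ p.1 x + p.2)
  have hfm : Measurable f := (measurable_importanceWeight hh M ν hπm).mul (measurable_ridge x)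
  have hfsq : Integrable (fun p => f p ^ 2) μ := by
    refine ⟨(hfm.pow_const 2).aestronglyMeasurable, ?_⟩
    rw [hasFiniteIntegral_iff_ofReal (ae_of_all _ fun _ => sq_nonneg _)]
    exact hsq.trans_lt ENNReal.ofReal_lt_top
  have hf2 : MemLp f 2 μ := (memLp_two_iff_integrable_sq hfm.aestronglyMeasurable).2 hfsq
  have hmean := integral_importanceWeight_mul_relu hν hM hπm hπpos hx
    (hf2.integrable (by norm_num))
  have hQ' : ∫ p, f p ^ 2 ∂μ ≤ Q := by
    rw [integral_eq_lintegral_of_nonneg_ae (ae_of_all _ fun _ => sq_nonneg _) hfsq.1]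
    exact ENNReal.toReal_le_of_le_ofReal hQ hsq
  -- Pairing `(A_i, B_i)` turns the product of the two families into `N` independent copies of one
  -- feature law.
  have hmp := measurePreserving_arrowProdEquivProdArrow (EuclideanSpace ℝ (Fin d)) ℝ (Fin N)
    (fun _ => studentT d ν) (fun _ => volume.withDensity fun z => ENNReal.ofReal (πb z))
  rw [MeasurePreserving.lintegral_map_equiv _ _ hmp]
  refine le_trans (le_of_eq ?_) ((lintegral_sq_mean_sub_le μ hf2 hN).trans
    (ENNReal.ofReal_le_ofReal (by gcongr)))
  refine lintegral_congr fun ω => ?_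
  rw [← hmean]
  congr 3
  refine Finset.sum_congr rfl fun i _ => ?_
  simp only [importanceWeights, f]
  rw [mul_assoc]
  rfl

end RandomFeature

/-! ### From the probabilistic setting to the risk bound -/

namespace RandomFeature

open scoped ENNReal

theorem IsIID.map_eq_pi {Ω ι E : Type*} [MeasurableSpace Ω] [MeasurableSpace E] [Fintype ι]
    {P : Measure Ω} [IsProbabilityMeasure P] {Z : ι → Ω → E} (hZ : IsIID P Z) (i₀ : ι) :
    P.map (fun ω i => Z i ω) = Measure.pi fun _ => P.map (Z i₀) := by
  rw [(iIndepFun_iff_map_fun_eq_pi_map fun i => (hZ.measurable i).aemeasurable).1 hZ.indep]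
  congr 1
  funext i
  exact (hZ.identDistrib i i₀).map_eq

/-- Conditional moment assumptions turn into properties of the joint law. -/
theorem isRegressionLaw_map {Ω 𝒳 : Type*} [mΩ : MeasurableSpace Ω] [MeasurableSpace 𝒳]
    {P : Measure Ω} [IsProbabilityMeasure P] {X : Ω → 𝒳} {Y : Ω → ℝ} (hX : Measurable X)
    (hY : Measurable Y) {m : 𝒳 → ℝ} (hm : Measurable m) {L σ : ℝ} (hmL : ∀ x, |m x| ≤ L)
    (hYi : Integrable Y P)
    (hreg : P[Y | MeasurableSpace.comap X inferInstance] =ᵐ[P] fun ω => m (X ω))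
    (hsq : Integrable (fun ω => (Y ω - m (X ω)) ^ 2) P)
    (hvar : P[fun ω => (Y ω - m (X ω)) ^ 2 | MeasurableSpace.comap X inferInstance]
      ≤ᵐ[P] fun _ => σ ^ 2) :
    IsRegressionLaw (P.map fun ω => (X ω, Y ω)) m σ := by
  have hXY : Measurable fun ω => (X ω, Y ω) := hX.prodMk hY
  have hle : MeasurableSpace.comap X inferInstance ≤ mΩ := hX.comap_le
  have hXm : Measurable[MeasurableSpace.comap X inferInstance] X := comap_measurable X
  have hnoise : Measurable fun z : 𝒳 × ℝ => z.2 - m z.1 :=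
    measurable_snd.sub (hm.comp measurable_fst)
  have hmi : Integrable (fun ω => m (X ω)) P :=
    Integrable.of_bound (hm.comp hX).aestronglyMeasurable L (ae_of_all _ fun ω => hmL _)
  have hεi : Integrable (fun ω => Y ω - m (X ω)) P := hYi.sub hmi
  refine ⟨hm, ?_, fun h hh hh1 => ?_, fun h hh hh1 hh0 => ?_⟩
  · rw [integrable_map_measure (hnoise.pow_const 2).aestronglyMeasurable hXY.aemeasurable]
    exact hsq
  · have hmul : Measurable fun z : 𝒳 × ℝ => h z.1 * (z.2 - m z.1) :=
      (hh.comp measurable_fst).mul hnoise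
    rw [integral_map hXY.aemeasurable hmul.aestronglyMeasurable]
    have hint : Integrable (fun ω => h (X ω) * (Y ω - m (X ω))) P :=
      hεi.bdd_mul (hh.comp hX).aestronglyMeasurable (ae_of_all _ fun ω => hh1 _)
    have h1 := condExp_mul_of_stronglyMeasurable_left (m := MeasurableSpace.comap X inferInstance)
      (μ := P) (f := fun ω => h (X ω)) (g := fun ω => Y ω - m (X ω))
      (hh.comp hXm).stronglyMeasurable hint hεi
    have h2 : P[fun ω => Y ω - m (X ω) | MeasurableSpace.comap X inferInstance] =ᵐ[P] 0 := by
      have h3 := condExp_sub hYi hmi (MeasurableSpace.comap X inferInstance)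
      have h4 := condExp_of_stronglyMeasurable hle (f := fun ω => m (X ω))
        (hm.comp hXm).stronglyMeasurable hmi
      filter_upwards [h3, hreg] with ω h3 h5
      change (P[Y - (fun ω => m (X ω)) | _]) ω = 0
      rw [h3, Pi.sub_apply, h5, h4, sub_self]
    rw [← integral_condExp hle]
    refine integral_eq_zero_of_ae ?_
    filter_upwards [h1, h2] with ω h1 h2
    change (P[(fun ω => h (X ω)) * (fun ω => Y ω - m (X ω)) | _]) ω = 0
    rw [h1, Pi.mul_apply, h2, Pi.zero_apply, mul_zero]
  · have hmul : Measurable fun z : 𝒳 × ℝ => h z.1 * (z.2 - m z.1) ^ 2 :=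
      (hh.comp measurable_fst).mul (hnoise.pow_const 2)
    have hfst : Measurable fun z : 𝒳 × ℝ => h z.1 := hh.comp measurable_fst
    rw [integral_map hXY.aemeasurable hmul.aestronglyMeasurable,
      integral_map hXY.aemeasurable hfst.aestronglyMeasurable, ← integral_const_mul]
    have hhi : Integrable (fun ω => h (X ω)) P :=
      Integrable.of_bound (hh.comp hX).aestronglyMeasurable 1 (ae_of_all _ fun ω => hh1 _)
    have hint : Integrable (fun ω => h (X ω) * (Y ω - m (X ω)) ^ 2) P :=
      hsq.bdd_mul (hh.comp hX).aestronglyMeasurable (ae_of_all _ fun ω => hh1 _)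
    have h1 := condExp_mul_of_stronglyMeasurable_left (m := MeasurableSpace.comap X inferInstance)
      (μ := P) (f := fun ω => h (X ω)) (g := fun ω => (Y ω - m (X ω)) ^ 2)
      (hh.comp hXm).stronglyMeasurable hint hsq
    rw [← integral_condExp hle]
    refine integral_mono_ae integrable_condExp (hhi.const_mul _) ?_
    filter_upwards [h1, hvar] with ω h1 h2
    change (P[(fun ω => h (X ω)) * (fun ω => (Y ω - m (X ω)) ^ 2) | _]) ω ≤ _
    rw [h1, Pi.mul_apply, mul_comm]
    exact mul_le_mul_of_nonneg_right h2 (hh0 _)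

variable {d N n : ℕ}

theorem measurable_network {α : Type*} [MeasurableSpace α]
    {a : α → Fin N → EuclideanSpace ℝ (Fin d)} {b w : α → Fin N → ℝ}
    {x : α → EuclideanSpace ℝ (Fin d)} (ha : Measurable a) (hb : Measurable b) (hw : Measurable w)
    (hx : Measurable x) : Measurable fun t => network (a t) (b t) (w t) (x t) := by
  refine Finset.measurable_sum _ fun i _ => ?_
  have hai : Measurable fun t => a t i := (measurable_pi_apply i).comp ha
  have hbi : Measurable fun t => b t i := (measurable_pi_apply i).comp hb
  have hwi : Measurable fun t => w t i := (measurable_pi_apply i).comp hw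
  have hin : Measurable fun t => inner ℝ (a t i) (x t) := hai.inner hx
  exact hwi.mul (measurable_relu.comp (hin.add hbi))

/-- A least-squares estimator, as a function of the observations, almost surely minimizes the sum
of squares over all deterministic weights. -/
theorem ae_leastSquares {Ω : Type*} [MeasurableSpace Ω] {P : Measure Ω} [NeZero n]
    {A : Fin N → Ω → EuclideanSpace ℝ (Fin d)} {B : Fin N → Ω → ℝ}
    {X : Fin n → Ω → EuclideanSpace ℝ (Fin d)} {Y : Fin n → Ω → ℝ}
    (hobs : Measurable (observed A B X Y))
    {w : ((Fin N → EuclideanSpace ℝ (Fin d)) × (Fin N → ℝ)) ×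
      (Fin n → EuclideanSpace ℝ (Fin d) × ℝ) → Fin N → ℝ} (hw : Measurable w)
    (hls : IsLeastSquaresWeight P A B X Y (w ∘ observed A B X Y)) :
    ∀ᵐ o ∂(P.map (observed A B X Y)), ∀ v : Fin N → ℝ,
      ∑ i, (∑ j, w o j * relu (inner ℝ (o.1.1 j) (o.2 i).1 + o.1.2 j) - (o.2 i).2) ^ 2 ≤
      ∑ i, (∑ j, v j * relu (inner ℝ (o.1.1 j) (o.2 i).1 + o.1.2 j) - (o.2 i).2) ^ 2 := by
  -- The exceptional null set in the minimality assumption depends on the competitor. Countably many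
  -- constant weights from a dense sequence give a common null set, and continuity of the risk in
  -- the weights extends the inequality to all of them.
  obtain ⟨q, hq⟩ := TopologicalSpace.exists_dense_seq (Fin N → ℝ)
  have hn : (0 : ℝ) < 1 / n := by
    have := NeZero.pos n
    positivity
  have hmeas : ∀ v : ((Fin N → EuclideanSpace ℝ (Fin d)) × (Fin N → ℝ)) ×
      (Fin n → EuclideanSpace ℝ (Fin d) × ℝ) → Fin N → ℝ, Measurable v → Measurable fun o =>
      ∑ i, (∑ j, v o j * relu (inner ℝ (o.1.1 j) (o.2 i).1 + o.1.2 j) - (o.2 i).2) ^ 2 :=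
    fun v hv => Finset.measurable_sum _ fun i _ => by
      have hx : Measurable fun o : ((Fin N → EuclideanSpace ℝ (Fin d)) × (Fin N → ℝ)) ×
          (Fin n → EuclideanSpace ℝ (Fin d) × ℝ) => o.2 i :=
        (measurable_pi_apply i).comp measurable_snd
      have hnet := measurable_network (measurable_fst.comp measurable_fst)
        (measurable_snd.comp measurable_fst) hv (measurable_fst.comp hx)
      exact (hnet.sub (measurable_snd.comp hx)).pow_const 2
  have hk : ∀ k, ∀ᵐ o ∂(P.map (observed A B X Y)),
      ∑ i, (∑ j, w o j * relu (inner ℝ (o.1.1 j) (o.2 i).1 + o.1.2 j) - (o.2 i).2) ^ 2 ≤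
      ∑ i, (∑ j, q k j * relu (inner ℝ (o.1.1 j) (o.2 i).1 + o.1.2 j) - (o.2 i).2) ^ 2 :=
      fun k => by
    rw [ae_map_iff hobs.aemeasurable
      (measurableSet_le (hmeas w hw) (hmeas (fun _ => q k) measurable_const))]
    filter_upwards [hls.2 (fun _ => q k) measurable_const] with ω hω
    simp only [empiricalRisk, network] at hω
    exact le_of_mul_le_mul_left hω hn
  filter_upwards [ae_all_iff.2 hk] with o ho v
  have hclosed : IsClosed {v : Fin N → ℝ |
      ∑ i, (∑ j, w o j * relu (inner ℝ (o.1.1 j) (o.2 i).1 + o.1.2 j) - (o.2 i).2) ^ 2 ≤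
      ∑ i, (∑ j, v j * relu (inner ℝ (o.1.1 j) (o.2 i).1 + o.1.2 j) - (o.2 i).2) ^ 2} :=
    isClosed_le continuous_const (by fun_prop)
  exact hclosed.closure_subset_iff.2 (by rintro _ ⟨k, rfl⟩; exact ho k) (hq v)

/-- Risk bound for random feature least squares in terms of the approximation error of given random
weights. -/
theorem lintegral_sq_sub_truncate_network_le [NeZero n]
    {θ : Measure ((Fin N → EuclideanSpace ℝ (Fin d)) × (Fin N → ℝ))} [IsProbabilityMeasure θ]
    {ρ : Measure (EuclideanSpace ℝ (Fin d) × ℝ)} [IsProbabilityMeasure ρ]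
    {H : EuclideanSpace ℝ (Fin d) → ℝ} {σ L : ℝ} (hρ : IsRegressionLaw ρ H σ) (hL : 0 ≤ L)
    (hHL : ∀ x, |H x| ≤ L)
    {w : ((Fin N → EuclideanSpace ℝ (Fin d)) × (Fin N → ℝ)) ×
      (Fin n → EuclideanSpace ℝ (Fin d) × ℝ) → Fin N → ℝ} (hw : Measurable w)
    (hmin : ∀ᵐ o ∂(θ.prod (Measure.pi fun _ => ρ)), ∀ v : Fin N → ℝ,
      ∑ i, (∑ j, w o j * relu (inner ℝ (o.1.1 j) (o.2 i).1 + o.1.2 j) - (o.2 i).2) ^ 2 ≤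
      ∑ i, (∑ j, v j * relu (inner ℝ (o.1.1 j) (o.2 i).1 + o.1.2 j) - (o.2 i).2) ^ 2)
    {v : (Fin N → EuclideanSpace ℝ (Fin d)) × (Fin N → ℝ) → Fin N → ℝ} (hv : Measurable v)
    {Q : ℝ≥0∞} (hQ : ∀ᵐ z ∂ρ,
      ∫⁻ t, ENNReal.ofReal ((H z.1 - network t.1 t.2 (v t) z.1) ^ 2) ∂θ ≤ Q) :
    ∫⁻ p, ENNReal.ofReal ((H p.2 - truncate L (network p.1.1.1 p.1.1.2 (w p.1) p.2)) ^ 2)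
      ∂((θ.prod (Measure.pi fun _ => ρ)).prod (ρ.map Prod.fst)) ≤
    2 * Q + ENNReal.ofReal (2 * σ ^ 2 * N / n +
      4 * L ^ 2 * (2 * N * Real.log (2 * n + 1) / (n * Real.log (3 / 2)))) := by
  have hH := hρ.measurable
  set c := ENNReal.ofReal (2 * σ ^ 2 * N / n +
      4 * L ^ 2 * (2 * N * Real.log (2 * n + 1) / (n * Real.log (3 / 2))))
  have : IsProbabilityMeasure (ρ.map Prod.fst) :=
    Measure.isProbabilityMeasure_map measurable_fst.aemeasurable
  have hG : Measurable fun p : (((Fin N → EuclideanSpace ℝ (Fin d)) × (Fin N → ℝ)) ×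
      (Fin n → EuclideanSpace ℝ (Fin d) × ℝ)) × EuclideanSpace ℝ (Fin d) =>
      ENNReal.ofReal ((H p.2 - truncate L (network p.1.1.1 p.1.1.2 (w p.1) p.2)) ^ 2) :=
    (((hH.comp measurable_snd).sub ((measurable_truncate L).comp
      (measurable_network (by fun_prop) (by fun_prop) (hw.comp measurable_fst)
        measurable_snd))).pow_const 2).ennreal_ofReal
  have hA : Measurable fun p : ((Fin N → EuclideanSpace ℝ (Fin d)) × (Fin N → ℝ)) ×
      (EuclideanSpace ℝ (Fin d) × ℝ) =>
      ENNReal.ofReal ((H p.2.1 - network p.1.1 p.1.2 (v p.1) p.2.1) ^ 2) :=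
    (((hH.comp (by fun_prop)).sub (measurable_network (by fun_prop) (by fun_prop)
      (hv.comp measurable_fst) (by fun_prop))).pow_const 2).ennreal_ofReal
  -- For frozen hidden weights `t` the features are deterministic and `v t` is a fixed competitor,
  -- so the oracle inequality applies.
  have hfix : ∀ᵐ t ∂θ, ∫⁻ z, ∫⁻ x, ENNReal.ofReal
      ((H x - truncate L (network t.1 t.2 (w (t, z)) x)) ^ 2) ∂(ρ.map Prod.fst)
        ∂(Measure.pi fun _ => ρ) ≤
      2 * ∫⁻ z, ENNReal.ofReal ((H z.1 - network t.1 t.2 (v t) z.1) ^ 2) ∂ρ + c := by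
    filter_upwards [Measure.ae_ae_of_ae_prod hmin] with t ht
    have hφ : Measurable fun (x : EuclideanSpace ℝ (Fin d)) (j : Fin N) =>
        relu (inner ℝ (t.1 j) x + t.2 j) :=
      measurable_pi_iff.2 fun j => measurable_relu.comp (by fun_prop)
    have horacle := hρ.lintegral_sq_sub_truncate_leastSquares_le (NeZero.ne n) hL hHL _ hφ
      (fun z => w (t, z)) (hw.comp (by fun_prop)) ht (v t)
    refine le_trans (le_of_eq ?_) horacle
    rw [lintegral_prod]
    · refine lintegral_congr fun z => ?_
      have hGz : Measurable fun x => ENNReal.ofReal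
          ((H x - truncate L (network t.1 t.2 (w (t, z)) x)) ^ 2) :=
        hG.comp (by fun_prop : Measurable fun x => ((t, z), x))
      rw [lintegral_map hGz measurable_fst]
      rfl
    · exact (hG.comp (by fun_prop : Measurable fun p : (Fin n → EuclideanSpace ℝ (Fin d) × ℝ) ×
        (EuclideanSpace ℝ (Fin d) × ℝ) => ((t, p.1), p.2.1))).aemeasurable
  rw [lintegral_prod _ hG.aemeasurable, lintegral_prod _ hG.lintegral_prod_right'.aemeasurable]
  calc _ ≤ ∫⁻ t, (2 * ∫⁻ z, ENNReal.ofReal ((H z.1 - network t.1 t.2 (v t) z.1) ^ 2) ∂ρ + c) ∂θ :=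
        lintegral_mono_ae hfix
    _ = 2 * ∫⁻ t, ∫⁻ z, ENNReal.ofReal ((H z.1 - network t.1 t.2 (v t) z.1) ^ 2) ∂ρ ∂θ + c := by
        rw [lintegral_add_right _ measurable_const, lintegral_const_mul _ hA.lintegral_prod_right']
        simp
    -- The order is exchanged because the approximation error is controlled at each fixed input,
    -- averaged over the hidden weights.
    _ = 2 * ∫⁻ z, ∫⁻ t, ENNReal.ofReal ((H z.1 - network t.1 t.2 (v t) z.1) ^ 2) ∂θ ∂ρ + c := by
        rw [lintegral_lintegral_swap hA.aemeasurable]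
    _ ≤ 2 * ∫⁻ _z, Q ∂ρ + c := by
        gcongr 2 * ?_ + c
        exact lintegral_mono_ae hQ
    _ = 2 * Q + c := by simp

/-- Rewriting of the risk bound as the sum of an estimation and an approximation term. -/
theorem rpow_half_risk_le {I K S D σ L : ℝ} (hK : 0 ≤ K) (hS : 0 ≤ S) (hD : 1 ≤ D)
    (hσ : 0 ≤ σ) (hL : 0 ≤ L) (hN : N ≠ 0) (hn : n ≠ 0)
    (hI : I ≤ 2 * (K * D * S ^ 2 / N) + (2 * σ ^ 2 * N / n +
      4 * L ^ 2 * (2 * N * Real.log (2 * n + 1) / (n * Real.log (3 / 2))))) :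
    I ^ (1 / 2 : ℝ) ≤
      (√(2 * K) + √(2 + 16 / Real.log (3 / 2))) * max σ L *
        ((Real.log n + 1) ^ (1 / 2 : ℝ) * √(N : ℝ)) / √(n : ℝ) +
      (√(2 * K) + √(2 + 16 / Real.log (3 / 2))) * S * D ^ 3 / √(N : ℝ) := by
  have hN' : (0 : ℝ) < N := by positivity
  have hn' : (0 : ℝ) < n := by positivity
  have hn1 : (1 : ℝ) ≤ n := by exact_mod_cast Nat.one_le_iff_ne_zero.2 hn
  have hlogn : 0 ≤ Real.log n := Real.log_nonneg hn1
  have hl : 0 < Real.log (3 / 2) := Real.log_pos (by norm_num)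
  set l := Real.log (3 / 2)
  set m := max σ L
  have hm0 : 0 ≤ m := hσ.trans (le_max_left _ _)
  -- `2n + 1 ≤ 3n`, and `log 3 ≤ 3 - 1 = 2`.
  have hlog : Real.log (2 * n + 1) ≤ 2 * (Real.log n + 1) := by
    calc _ ≤ Real.log (3 * n) := Real.log_le_log (by positivity) (by linarith)
      _ = Real.log 3 + Real.log n := Real.log_mul (by norm_num) hn'.ne'
      _ ≤ _ := by
        have := Real.log_le_sub_one_of_pos (show (0 : ℝ) < 3 by norm_num)
        linarith
  have hlog0 : 0 ≤ Real.log (2 * n + 1) := Real.log_nonneg (by linarith)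
  have hest : 2 * σ ^ 2 * N / n + 4 * L ^ 2 * (2 * N * Real.log (2 * n + 1) / (n * l)) ≤
      (2 + 16 / l) * (m ^ 2 * ((Real.log n + 1) * N) / n) := by
    have h1 : σ ^ 2 ≤ m ^ 2 := by gcongr; exact le_max_left _ _
    have h2 : L ^ 2 ≤ m ^ 2 := by gcongr; exact le_max_right _ _
    calc _ ≤ 2 * m ^ 2 * N / n + 4 * m ^ 2 * (2 * N * (2 * (Real.log n + 1)) / (n * l)) := by
          gcongr
      _ ≤ 2 * m ^ 2 * (N * (Real.log n + 1)) / n +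
          4 * m ^ 2 * (2 * N * (2 * (Real.log n + 1)) / (n * l)) := by
          gcongr
          exact le_mul_of_one_le_right hN'.le (by linarith)
      _ = _ := by field_simp; ring
  -- A lossy step: the square root of the bound grows only like `D^(1/2)`, and is relaxed to `D³`
  -- using `D ≥ 1`.
  have happ : 2 * (K * D * S ^ 2 / N) ≤ 2 * K * (S ^ 2 * (D ^ 3) ^ 2 / N) := by
    have : D ≤ (D ^ 3) ^ 2 := by
      rw [← pow_mul]
      exact le_self_pow₀ hD (by norm_num)
    calc _ = 2 * K * (S ^ 2 * D / N) := by ring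
      _ ≤ _ := by gcongr
  rw [← Real.sqrt_eq_rpow, ← Real.sqrt_eq_rpow]
  set c := √(2 * K)
  set e := √(2 + 16 / l)
  have hc : 0 ≤ c := Real.sqrt_nonneg _
  have he : 0 ≤ e := Real.sqrt_nonneg _
  calc √I ≤ √(2 * K * (S ^ 2 * (D ^ 3) ^ 2 / N) +
        (2 + 16 / l) * (m ^ 2 * ((Real.log n + 1) * N) / n)) :=
        Real.sqrt_le_sqrt (hI.trans (add_le_add happ hest))
    _ ≤ √(2 * K * (S ^ 2 * (D ^ 3) ^ 2 / N)) +
        √((2 + 16 / l) * (m ^ 2 * ((Real.log n + 1) * N) / n)) := by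
        refine Real.sqrt_le_iff.2 ⟨by positivity, ?_⟩
        have h1 := Real.sq_sqrt (show 0 ≤ 2 * K * (S ^ 2 * (D ^ 3) ^ 2 / N) by positivity)
        have h2 := Real.sq_sqrt (show 0 ≤ (2 + 16 / l) * (m ^ 2 * ((Real.log n + 1) * N) / n) by
          positivity)
        rw [add_sq, h1, h2]
        have := Real.sqrt_nonneg (2 * K * (S ^ 2 * (D ^ 3) ^ 2 / N))
        have := Real.sqrt_nonneg ((2 + 16 / l) * (m ^ 2 * ((Real.log n + 1) * N) / n))
        have : 0 ≤ 2 * √(2 * K * (S ^ 2 * (D ^ 3) ^ 2 / N)) *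
          √((2 + 16 / l) * (m ^ 2 * ((Real.log n + 1) * N) / n)) := by positivity
        linarith
    _ = c * S * D ^ 3 / √N + e * m * (√(Real.log n + 1) * √N) / √n := by
        have h1 : √(2 * K * (S ^ 2 * (D ^ 3) ^ 2 / N)) = c * (S * D ^ 3 / √N) := by
          rw [Real.sqrt_mul (show 0 ≤ 2 * K by positivity), Real.sqrt_div (by positivity),
            ← mul_pow, Real.sqrt_sq (by positivity)]
        have h2 : √((2 + 16 / l) * (m ^ 2 * ((Real.log n + 1) * N) / n)) =
            e * (m * (√(Real.log n + 1) * √N) / √n) := by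
          rw [Real.sqrt_mul (show 0 ≤ 2 + 16 / l by positivity), Real.sqrt_div (by positivity),
            Real.sqrt_mul (sq_nonneg m), Real.sqrt_sq hm0, Real.sqrt_mul (by positivity)]
        rw [h1, h2]
        ring
    _ ≤ (c + e) * S * D ^ 3 / √N + (c + e) * m * (√(Real.log n + 1) * √N) / √n := by
        gcongr <;> linarith
    _ = _ := add_comm _ _

end RandomFeature

/-! ### The main theorem -/

theorem mainTheorem5
    (πb : ℝ → ℝ) (hπb_meas : Measurable πb)
    (hπb : RandomFeature.AtMostPolynomialDecay πb) :
    ∃ k : ℕ, ∀ (ν C M : ℝ), 1 < ν → 1 / (2 ^ (3 / 2 : ℝ) * Real.pi) < C → 0 < M →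
    ∃ Capp : ℝ, 0 < Capp ∧
    ∀ (d N n : ℕ) [NeZero d] [NeZero N] [NeZero n]
      (Ω : Type*) [MeasurableSpace Ω] (P : Measure Ω) [IsProbabilityMeasure P]
      -- hidden weights
      (A : Fin N → Ω → EuclideanSpace ℝ (Fin d)) (B : Fin N → Ω → ℝ)
      (_ : RandomFeature.IsIID P A) (_ : RandomFeature.IsIID P B)
      (_ : IndepFun (fun ω i => A i ω) (fun ω i => B i ω) P)
      (_ : P.map (A 0) = RandomFeature.studentT d ν)
      (_ : P.map (B 0) = volume.withDensity (fun z => ENNReal.ofReal (πb z)))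
      -- data
      (X : Fin n → Ω → EuclideanSpace ℝ (Fin d)) (Y : Fin n → Ω → ℝ)
      (_ : RandomFeature.IsIID P (fun i ω => (X i ω, Y i ω)))
      (_ : IndepFun (RandomFeature.data X Y) (RandomFeature.hidden A B) P)
      -- test point
      (Xbar : Ω → EuclideanSpace ℝ (Fin d))
      (_ : IdentDistrib Xbar (X 0) P P)
      (_ : IndepFun Xbar (RandomFeature.observed A B X Y) P)
      -- target function
      (H Φ : EuclideanSpace ℝ (Fin d) → ℝ) (V : Ω → EuclideanSpace ℝ (Fin d))
      (_ : Integrable Φ volume) (_ : Measurable V)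
      (_ : ∀ ξ, ‖charFun (P.map V) ξ‖ ≤ Real.exp (-C * ‖ξ‖ ^ 2))
      (_ : ∀ x, H x = ∫ ω, Φ (x + V ω) ∂P)
      -- regression function, bounded inputs, conditional variance and bound on the target
      (_ : Integrable (Y 0) P)
      (_ : P[Y 0 | MeasurableSpace.comap (X 0) inferInstance] =ᵐ[P] fun ω => H (X 0 ω))
      (_ : ∀ᵐ ω ∂P, ∀ j, |X 0 ω j| ≤ M)
      (σ L : ℝ) (_ : 0 ≤ σ) (_ : 0 < L)
      (_ : Integrable (fun ω => (Y 0 ω - H (X 0 ω)) ^ 2) P)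
      (_ : P[fun ω => (Y 0 ω - H (X 0 ω)) ^ 2 | MeasurableSpace.comap (X 0) inferInstance]
        ≤ᵐ[P] fun _ => σ ^ 2)
      (_ : ∀ x, |H x| ≤ L)
      -- least-squares estimator
      (What : Ω → Fin N → ℝ) (_ : RandomFeature.IsLeastSquaresWeight P A B X Y What),
      Integrable (fun ω => |H (Xbar ω) - RandomFeature.truncate L
        (RandomFeature.network (fun i => A i ω) (fun i => B i ω) (What ω) (Xbar ω))| ^ 2) P ∧
      (∫ ω, |H (Xbar ω) - RandomFeature.truncate L
        (RandomFeature.network (fun i => A i ω) (fun i => B i ω) (What ω) (Xbar ω))| ^ 2 ∂P)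
          ^ (1 / 2 : ℝ) ≤
        Capp * max σ L * ((Real.log n + 1) ^ (1 / 2 : ℝ) * √(N : ℝ)) / √(n : ℝ) +
          Capp * (∫ x, ‖Φ x‖) * (ν + d) ^ (k + 3) / √(N : ℝ) := by

  -- The decay degree of `π_b` affects only the constant, so no extra power of the dimension is
  -- needed.
  refine ⟨0, fun ν C M hν hC hM => ?_⟩
  have hν0 : 0 < ν := one_pos.trans hν
  have hpi := Real.pi_pos
  have hC0 : 0 < C := lt_trans (by positivity) hC
  obtain ⟨hπpos, -⟩ := hπb.exists_inv_le one_pos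
  obtain ⟨K, hK, hKle⟩ :=
    RandomFeature.exists_lintegral_sq_importanceWeight_le hπb_meas hπb hν0 hC hM
  have hl : 0 < Real.log (3 / 2) := Real.log_pos (by norm_num)
  refine ⟨√(2 * K) + √(2 + 16 / Real.log (3 / 2)), by positivity, ?_⟩
  intro d N n _ _ _ Ω _ P _ A B hA hB hAB hAlaw hBlaw X Y hXY hdata Xbar hXbar hXbar_indep H Φ V
    hΦ hV hchar hH hY hreg hXM σ L hσ hL hnoise hvar hHL What hls
  have hX : ∀ i, Measurable (X i) := fun i => (hXY.measurable i).fst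
  have hYm : ∀ i, Measurable (Y i) := fun i => (hXY.measurable i).snd
  have : IsProbabilityMeasure (P.map V) := Measure.isProbabilityMeasure_map hV.aemeasurable
  have : IsProbabilityMeasure (RandomFeature.studentT d ν) :=
    hAlaw ▸ Measure.isProbabilityMeasure_map (hA.measurable 0).aemeasurable
  have : IsProbabilityMeasure (volume.withDensity fun z => ENNReal.ofReal (πb z)) :=
    hBlaw ▸ Measure.isProbabilityMeasure_map (hB.measurable 0).aemeasurable
  -- the target as a superposition of plane waves
  obtain ⟨hΦm, h, hhm, hhle, hrep⟩ :=
    RandomFeature.exists_planeWave_representation (P.map V) hC0 hchar hΦ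
  have hHrep : ∀ x, H x = ∫ ξ, (h ξ * Complex.exp ((inner ℝ ξ x : ℝ) * Complex.I)).re := fun x => by
    rw [hH, ← hrep, integral_map hV.aemeasurable (hΦm x)]
  -- Measurability of the target is not assumed; it follows from the wave representation as a
  -- parametric integral.
  have hHm : Measurable H := by
    have hint : Measurable fun p : EuclideanSpace ℝ (Fin d) × EuclideanSpace ℝ (Fin d) =>
        (h p.2 * Complex.exp ((inner ℝ p.2 p.1 : ℝ) * Complex.I)).re := by fun_prop
    rw [funext hHrep]
    exact hint.stronglyMeasurable.integral_prod_right.measurable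
  -- laws
  set ρ := P.map fun ω => (X 0 ω, Y 0 ω)
  have : IsProbabilityMeasure ρ :=
    Measure.isProbabilityMeasure_map (hXY.measurable 0).aemeasurable
  have hρ : RandomFeature.IsRegressionLaw ρ H σ :=
    RandomFeature.isRegressionLaw_map (hX 0) (hYm 0) hHm hHL hY hreg hnoise hvar
  have hρfst : ρ.map Prod.fst = P.map (X 0) := by
    rw [Measure.map_map measurable_fst (hXY.measurable 0)]
    rfl
  set θ := (Measure.pi fun _ : Fin N => RandomFeature.studentT d ν).prod
    (Measure.pi fun _ : Fin N => volume.withDensity fun z => ENNReal.ofReal (πb z))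
  have hAm : Measurable fun ω i => A i ω := measurable_pi_iff.2 hA.measurable
  have hBm : Measurable fun ω i => B i ω := measurable_pi_iff.2 hB.measurable
  have hhid : Measurable (RandomFeature.hidden A B) := hAm.prodMk hBm
  have hdat : Measurable (RandomFeature.data X Y) := measurable_pi_iff.2 hXY.measurable
  have hobs : Measurable (RandomFeature.observed A B X Y) := hhid.prodMk hdat
  have hθ : P.map (RandomFeature.hidden A B) = θ := by
    have := (indepFun_iff_map_prod_eq_prod_map_map hAm.aemeasurable hBm.aemeasurable).1 hAB
    rw [hA.map_eq_pi 0, hB.map_eq_pi 0, hAlaw, hBlaw] at this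
    exact this
  have hobslaw : P.map (RandomFeature.observed A B X Y) = θ.prod (Measure.pi fun _ => ρ) := by
    have := (indepFun_iff_map_prod_eq_prod_map_map hhid.aemeasurable hdat.aemeasurable).1 hdata.symm
    rw [hθ, show P.map (RandomFeature.data X Y) = Measure.pi fun _ => ρ from hXY.map_eq_pi 0]
      at this
    exact this
  have hjoint : P.map (fun ω => (RandomFeature.observed A B X Y ω, Xbar ω)) =
      (θ.prod (Measure.pi fun _ => ρ)).prod (ρ.map Prod.fst) := by
    rw [(indepFun_iff_map_prod_eq_prod_map_map hobs.aemeasurable hXbar.aemeasurable_fst).1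
      hXbar_indep.symm, hobslaw, hXbar.map_eq, hρfst]
  -- the estimator and its risk
  obtain ⟨w, hw, rfl⟩ := Measurable.exists_eq_measurable_comp hls.1
  have hmin := RandomFeature.ae_leastSquares hobs hw hls
  rw [hobslaw] at hmin
  set S := ∫ x, ‖Φ x‖
  have hS : 0 ≤ S := integral_nonneg fun _ => norm_nonneg _
  have hQ0 : 0 ≤ K * (ν + d) * S ^ 2 := by positivity
  have hQ : ∀ᵐ z ∂ρ, ∫⁻ t, ENNReal.ofReal ((H z.1 - RandomFeature.network t.1 t.2
      (RandomFeature.importanceWeights h M ν πb t) z.1) ^ 2) ∂θ ≤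
        ENNReal.ofReal (K * (ν + d) * S ^ 2 / N) := by
    have hmeas : MeasurableSet {z : EuclideanSpace ℝ (Fin d) × ℝ | ∀ j, |z.1 j| ≤ M} := by
      simp only [Set.ofPred_forall]
      exact MeasurableSet.iInter fun j => measurableSet_le (by fun_prop) measurable_const
    have hz : ∀ᵐ z ∂ρ, ∀ j, |z.1 j| ≤ M :=
      (ae_map_iff (hXY.measurable 0).aemeasurable hmeas).2 hXM
    filter_upwards [hz] with z hz
    simp only [hHrep]
    exact RandomFeature.lintegral_sq_sub_network_le hν0 hM.le hπb_meas hπpos hhm (NeZero.ne N) hz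
      hQ0 (hKle d h S hhm hS hhle _ hz)
  have hrisk := RandomFeature.lintegral_sq_sub_truncate_network_le hρ hL.le hHL hw hmin
    (RandomFeature.measurable_importanceWeights hhm M ν hπb_meas) hQ
  have hG : Measurable fun p : (((Fin N → EuclideanSpace ℝ (Fin d)) × (Fin N → ℝ)) ×
      (Fin n → EuclideanSpace ℝ (Fin d) × ℝ)) × EuclideanSpace ℝ (Fin d) =>
      (H p.2 - RandomFeature.truncate L
        (RandomFeature.network p.1.1.1 p.1.1.2 (w p.1) p.2)) ^ 2 :=
    ((hHm.comp measurable_snd).sub ((RandomFeature.measurable_truncate L).comp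
      (RandomFeature.measurable_network (by fun_prop) (by fun_prop) (hw.comp measurable_fst)
        measurable_snd))).pow_const 2
  have hpair : AEMeasurable (fun ω => (RandomFeature.observed A B X Y ω, Xbar ω)) P :=
    hobs.aemeasurable.prodMk hXbar.aemeasurable_fst
  rw [← hjoint, lintegral_map' hG.ennreal_ofReal.aemeasurable hpair] at hrisk
  simp only [sq_abs]
  have hGω : AEStronglyMeasurable (fun ω => (H (Xbar ω) - RandomFeature.truncate L
      (RandomFeature.network (fun i => A i ω) (fun i => B i ω)
        ((w ∘ RandomFeature.observed A B X Y) ω) (Xbar ω))) ^ 2) P :=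
    (hG.comp_aemeasurable hpair).aestronglyMeasurable
  have hl0 : 0 ≤ Real.log (2 * n + 1) :=
    Real.log_nonneg (le_add_of_nonneg_left (by positivity))
  refine ⟨⟨hGω, ?_⟩, RandomFeature.rpow_half_risk_le hK hS ?_ hσ hL.le (NeZero.ne N) (NeZero.ne n)
    ?_⟩
  · rw [hasFiniteIntegral_iff_ofReal (ae_of_all _ fun _ => sq_nonneg _)]
    exact hrisk.trans_lt (by finiteness)
  · linarith [Nat.cast_nonneg (α := ℝ) d]
  · rw [integral_eq_lintegral_of_nonneg_ae (ae_of_all _ fun _ => sq_nonneg _) hGω]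
    refine ENNReal.toReal_le_of_le_ofReal (by positivity) (hrisk.trans_eq ?_)
    have happ : 0 ≤ 2 * (K * (ν + d) * S ^ 2 / N) := by positivity
    have hest : 0 ≤ 2 * σ ^ 2 * N / n +
        4 * L ^ 2 * (2 * N * Real.log (2 * n + 1) / (n * Real.log (3 / 2))) := by positivity
    rw [ENNReal.ofReal_add happ hest, ENNReal.ofReal_mul zero_le_two, ENNReal.ofReal_ofNat]
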